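/- An election consists of a finite set $C$ of alternatives and a finite set of voters, each of whom has a linear order (preference order) over $C$. An alternative is a Plurality winner if the number of voters ranking it first is maximum among all alternatives. An alternative $c$ is the Condorcet winner if for every alternative $c' \neq c$ strictly more voters prefer $c$ to $c'$ than prefer $c'$ to $c$; Condorcet's rule elects the Condorcet winner if it exists, and nobody otherwise. An election with voter set $X$ is single-crossing if there is a linear order $L$ over $X$ such that for all alternatives $a,b$ and all voters $v_1 \mathrel{L} v_2 \mathrel{L} v_3$: if $v_1$ and $v_3$ both prefer $a$ to $b$, then so does $v_2$. The swap distance of two preference orders is the minimum number of swaps of consecutive alternatives that transform one into the other. For a voting rule $\mathcal{R}$, the problem $\mathcal{R}$-C-CC-AV (combinatorial constructive control by adding voters) is the following. The input consists of an election $(C,V)$, a set $W$ of unregistered voters with $V \cap W = \emptyset$ and with preference orders over $C$, a bundling function $\kappa : W \to 2^{W}$ with $w \in \kappa(w)$ for all $w \in W$ (given explicitly, by listing the members of each $\kappa(w)$), an alternative $p \in C$, and a number $k \in \mathbb{N}$. The question is whether there is a set $W' \subseteq W$ with $|W'| \le k$ such that $p$ is one of the $\mathcal{R}$-winners of the election $\bigl(C,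 V \cup \bigcup_{w \in W'} \kappa(w)\bigr)$. For $d \in \mathbb{N}$, the function $\kappa$ is full-$d$ if for every $x \in W$ the set $\kappa(x)$ consists of exactly those $y \in W$ whose preference order has swap distance at most $d$ from that of $x$. Theorem. There are deterministic algorithms for Plurality-C-CC-AV and for Condorcet-C-CC-AV which, on every instance such that the election $(C, V \cup W)$ is single-crossing and $\kappa$ is full-$d$ for some $d \in \mathbb{N}$, correctly decide the instance within a number of steps that is polynomial in the length of the input. (Neither a single-crossing order of the voters nor the number $d$ is part of the input; the polynomial depends neither on $d$ nor on any other part of the instance. Algorithms are programs of a random access machine with addition and subtraction as its arithmetic and unit cost per operation, and the length of an input is measured with all numbers written in binary.) -/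

import Mathlib

/-! ## Random access machine programs and polynomial time -/

namespace RAM

/-- A memory state: registers, and arrays with unboundedly many cells, all holding natural numbers.
A program mentions only finitely many registers and arrays. -/
structure State where
  reg : ℕ → ℕ
  arr : ℕ → ℕ → ℕ

/-- Arithmetic expressions. `get a e` reads the cell of array `a` whose index is the value of `e`. -/
inductive Expr where
  | lit (n : ℕ) : Expr
  | reg (x : ℕ) : Expr
  | get (a : ℕ) (e : Expr) : Expr
  | add (e f : Expr) : Expr
  | sub (e f : Expr) : Expr

/-- The value of an expression; the subtraction is truncated at `0`. -/
def Expr.eval (s : State) : Expr → ℕ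
  | .lit n => n
  | .reg x => s.reg x
  | .get a e => s.arr a (e.eval s)
  | .add e f => e.eval s + f.eval s
  | .sub e f => e.eval s - f.eval s

/-- The number of elementary operations used in evaluating an expression. -/
def Expr.cost : Expr → ℕ
  | .lit _ => 1
  | .reg _ => 1
  | .get _ e => e.cost + 1
  | .add e f => e.cost + f.cost + 1
  | .sub e f => e.cost + f.cost + 1

/-- Programs of the random access machine, in structured form. The conditions of `cond` and `loop`
count as true when their value is not `0`. -/
inductive Program where
  | skip : Program
  | assign (x : ℕ) (e : Expr) : Program
  | write (a : ℕ) (e f : Expr) : Program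
  | seq (P Q : Program) : Program
  | cond (e : Expr) (P Q : Program) : Program
  | loop (e : Expr) (P : Program) : Program

/-- Set register `x` to the value `n`. -/
def State.setReg (s : State) (x n : ℕ) : State :=
  { s with reg := Function.update s.reg x n }

/-- Set the cell with index `i` of array `a` to the value `n`. -/
def State.setArr (s : State) (a i n : ℕ) : State :=
  { s with arr := Function.update s.arr a (Function.update (s.arr a) i n) }

/-- `Exec P s t s'`: started in the state `s`, the program `P` halts in the state `s'` after `t`
elementary steps. Every elementary operation costs one step. The only arithmetic operations are
addition and subtraction, so `t` steps lengthen the largest number by at most `t` bits plus a constant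
that depends on the program, and the step count is polynomially related to Turing machine time. -/
inductive Exec : Program → State → ℕ → State → Prop where
  | skip (s : State) : Exec .skip s 1 s
  | assign (x : ℕ) (e : Expr) (s : State) :
      Exec (.assign x e) s (e.cost + 1) (s.setReg x (e.eval s))
  | write (a : ℕ) (e f : Expr) (s : State) :
      Exec (.write a e f) s (e.cost + f.cost + 1) (s.setArr a (e.eval s) (f.eval s))
  | seq {P Q : Program} {s s₁ s₂ : State} {t₁ t₂ : ℕ} :
      Exec P s t₁ s₁ → Exec Q s₁ t₂ s₂ → Exec (.seq P Q) s (t₁ + t₂) s₂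
  | cond_true {e : Expr} {P Q : Program} {s s₁ : State} {t : ℕ} :
      e.eval s ≠ 0 → Exec P s t s₁ → Exec (.cond e P Q) s (e.cost + 1 + t) s₁
  | cond_false {e : Expr} {P Q : Program} {s s₁ : State} {t : ℕ} :
      e.eval s = 0 → Exec Q s t s₁ → Exec (.cond e P Q) s (e.cost + 1 + t) s₁
  | loop_false {e : Expr} {P : Program} {s : State} :
      e.eval s = 0 → Exec (.loop e P) s (e.cost + 1) s
  | loop_true {e : Expr} {P : Program} {s s₁ s₂ : State} {t₁ t₂ : ℕ} :
      e.eval s ≠ 0 → Exec P s t₁ s₁ → Exec (.loop e P) s₁ t₂ s₂ →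
        Exec (.loop e P) s (e.cost + 1 + t₁ + t₂) s₂

/-- The machine is deterministic. -/
theorem Exec.deterministic {P : Program} {s s₁ s₂ : State} {t₁ t₂ : ℕ}
    (h₁ : Exec P s t₁ s₁) (h₂ : Exec P s t₂ s₂) : t₁ = t₂ ∧ s₁ = s₂ := by
  induction h₁ generalizing t₂ s₂ with
  | skip | assign | write => cases h₂; exact ⟨rfl, rfl⟩
  | seq _ _ ih₁ ih₂ =>
    cases h₂ with
    | seq a b =>
      obtain ⟨rfl, rfl⟩ := ih₁ a
      obtain ⟨rfl, rfl⟩ := ih₂ b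
      exact ⟨rfl, rfl⟩
  | cond_true h _ ih =>
    cases h₂ with
    | cond_true _ a => obtain ⟨rfl, rfl⟩ := ih a; exact ⟨rfl, rfl⟩
    | cond_false h' _ => exact absurd h' h
  | cond_false h _ ih =>
    cases h₂ with
    | cond_true h' _ => exact absurd h h'
    | cond_false _ a => obtain ⟨rfl, rfl⟩ := ih a; exact ⟨rfl, rfl⟩
  | loop_false h =>
    cases h₂ with
    | loop_false _ => exact ⟨rfl, rfl⟩
    | loop_true h' _ _ => exact absurd h h'
  | loop_true h _ _ ih₁ ih₂ =>
    cases h₂ with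
    | loop_false h' => exact absurd h' h
    | loop_true _ a b =>
      obtain ⟨rfl, rfl⟩ := ih₁ a
      obtain ⟨rfl, rfl⟩ := ih₂ b
      exact ⟨rfl, rfl⟩

/-- The initial state on input `l`: register `0` holds the number of entries of `l`, array `0` holds
the entries, and everything else is `0`. -/
def initState (l : List ℕ) : State where
  reg := fun x => if x = 0 then l.length else 0
  arr := fun a i => if a = 0 then l.getD i 0 else 0

/-- The length of an input: the entries are written in binary, each followed by a separator. -/
def inputLength (l : List ℕ) : ℕ :=
  (l.map fun a => a.size + 1).sum

/-- `PolyTimeSolvable enc Valid Yes`: a single program, on the encoding `enc a` of each instance `a`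
with `Valid a`, halts within a number of steps that is polynomial in the input length, and correctly
decides whether `Yes a` holds (the answer is yes if and only if register `0` is finally nonzero). -/
def PolyTimeSolvable {α : Type} (enc : α → List ℕ) (Valid Yes : α → Prop) : Prop :=
  ∃ (P : Program) (T : Polynomial ℕ), ∀ a : α, Valid a →
    ∃ (t : ℕ) (s : State), Exec P (initState (enc a)) t s ∧
      t ≤ T.eval (inputLength (enc a)) ∧ (s.reg 0 ≠ 0 ↔ Yes a)

end RAM

/-! ## Elections -/

/-- A preference order over the `m` alternatives `Fin m`, listed from the first to the last position:
`π i` is the alternative in position `i`. -/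
abbrev PrefOrder (m : ℕ) : Type := Equiv.Perm (Fin m)

/-- `π.Prefers a b`: the alternative `a` is ranked above the alternative `b`. -/
abbrev PrefOrder.Prefers {m : ℕ} (π : PrefOrder m) (a b : Fin m) : Prop :=
  π.symm a < π.symm b

/-- `π.IsTop a`: the alternative `a` is in the first position. -/
abbrev PrefOrder.IsTop {m : ℕ} (π : PrefOrder m) (a : Fin m) : Prop :=
  (π.symm a : ℕ) = 0

/-- `SwapSteps n π ρ`: some `n` successive swaps of consecutive alternatives transform `π` to `ρ`. -/
inductive SwapSteps {m : ℕ} : ℕ → PrefOrder m → PrefOrder m → Prop where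
  | refl (π : PrefOrder m) : SwapSteps 0 π π
  | step {n : ℕ} {π ρ : PrefOrder m} (i : ℕ) (hi : i + 1 < m) : SwapSteps n π ρ →
      SwapSteps (n + 1) π (ρ * Equiv.swap ⟨i, Nat.lt_of_succ_lt hi⟩ ⟨i + 1, hi⟩)

/-- The swap distance: the minimum number of swaps of consecutive alternatives that transform one
preference order into the other. -/
noncomputable def swapDist {m : ℕ} (π ρ : PrefOrder m) : ℕ :=
  sInf {n | SwapSteps n π ρ}

/-- Any preference order can be transformed into any other, so `swapDist` is an actual minimum. -/
theorem exists_swapSteps {m : ℕ} (π ρ : PrefOrder m) : ∃ n, SwapSteps n π ρ := by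
  cases m with
  | zero => exact ⟨0, by rw [Subsingleton.elim ρ π]; exact .refl π⟩
  | succ m =>
    have key : ∀ σ : Equiv.Perm (Fin (m + 1)), ∀ π : PrefOrder (m + 1),
        ∃ n, SwapSteps n π (π * σ) := by
      intro σ
      have hσ : σ ∈ Submonoid.closure
          (Set.range fun i : Fin m => Equiv.swap i.castSucc i.succ) := by
        rw [Equiv.Perm.mclosure_swap_castSucc_succ]; trivial
      induction hσ using Submonoid.closure_induction_right with
      | one => intro π; exact ⟨0, by simpa using SwapSteps.refl π⟩
      | mul_right x _ y hy ih =>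
        intro π
        obtain ⟨i, rfl⟩ := hy
        obtain ⟨n, hn⟩ := ih π
        refine ⟨n + 1, ?_⟩
        rw [← mul_assoc]
        exact SwapSteps.step i.1 (Nat.succ_lt_succ i.2) hn
    obtain ⟨n, hn⟩ := key (π⁻¹ * ρ) π
    exact ⟨n, by simpa using hn⟩

/-- A profile of voters `X` over `m` alternatives is single-crossing if for some linear order of the
voters, any voter between two voters that both prefer `a` to `b` prefers `a` to `b`, too. -/
def SingleCrossing {m : ℕ} {X : Type} (pref : X → PrefOrder m) : Prop :=
  ∃ L : LinearOrder X, ∀ (a b : Fin m) (v₁ v₂ v₃ : X), L.lt v₁ v₂ → L.lt v₂ v₃ →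
    (pref v₁).Prefers a b → (pref v₃).Prefers a b → (pref v₂).Prefers a b

/-- A voting rule maps an election, given by a finite set of voters and their preference orders, to
the (possibly empty) set of its winners. -/
abbrev VotingRule : Type 1 :=
  ∀ {m : ℕ} {X : Type}, Finset X → (X → PrefOrder m) → Set (Fin m)

/-- The number of voters that have the alternative `c` in the first position. -/
def pluralityScore {m : ℕ} {X : Type} (S : Finset X) (pref : X → PrefOrder m) (c : Fin m) : ℕ :=
  (S.filter fun v => (pref v).IsTop c).card

/-- The Plurality rule: all alternatives with the maximum Plurality score win. -/
def pluralityRule : VotingRule := fun S pref =>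
  {c | ∀ c', pluralityScore S pref c' ≤ pluralityScore S pref c}

/-- The Condorcet rule: an alternative wins if it beats every other alternative head-to-head. -/
def condorcetRule : VotingRule := fun S pref =>
  {c | ∀ c', c' ≠ c →
    (S.filter fun v => (pref v).Prefers c' c).card < (S.filter fun v => (pref v).Prefers c c').card}

/-! ## Combinatorial constructive control by adding voters -/

/-- An instance: `m` alternatives, `nV` registered and `nW` unregistered voters with their preference
orders, a bundling function on the unregistered voters, a preferred alternative `p` and a bound
`k`. -/
structure CCCAV where
  m : ℕ
  nV : ℕ
  nW : ℕ
  regPref : Fin nV → PrefOrder m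
  unregPref : Fin nW → PrefOrder m
  bundle : Fin nW → Finset (Fin nW)
  self_mem_bundle : ∀ w, w ∈ bundle w
  p : Fin m
  k : ℕ

namespace CCCAV

variable (I : CCCAV)

/-- The preference orders of all voters: the registered and the unregistered ones, which are
disjoint. -/
def pref : Fin I.nV ⊕ Fin I.nW → PrefOrder I.m :=
  Sum.elim I.regPref I.unregPref

/-- The voters that take part in the election once the leaders `W'` are chosen: all registered voters,
and all unregistered voters in the bundle of a leader. -/
def finalVoters (W' : Finset (Fin I.nW)) : Finset (Fin I.nV ⊕ Fin I.nW) :=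
  Finset.univ.disjSum (W'.biUnion I.bundle)

/-- The question: can at most `k` unregistered voters be chosen so that `p` is among the winners of
the resulting election? -/
def HasSolution (R : VotingRule) : Prop :=
  ∃ W' : Finset (Fin I.nW), W'.card ≤ I.k ∧ I.p ∈ R (I.finalVoters W') I.pref

/-- The bundling function is full-`d`: the bundle of `x` consists of exactly the unregistered voters
within swap distance `d` of `x`. -/
def IsFull (d : ℕ) : Prop :=
  ∀ x y : Fin I.nW, y ∈ I.bundle x ↔ swapDist (I.unregPref x) (I.unregPref y) ≤ d

/-- A preference order, written as the list of its alternatives from first to last. -/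
def encodePref {m : ℕ} (π : PrefOrder m) : List ℕ :=
  (List.finRange m).map fun i => (π i : ℕ)

/-- A bundle, written as the number of its members followed by the members in increasing order. -/
def encodeBundle {n : ℕ} (B : Finset (Fin n)) : List ℕ :=
  B.card :: (B.sort (· ≤ ·)).map fun w => (w : ℕ)

/-- The input: the five numbers, then the preference orders of the registered voters, those of the
unregistered voters, and the bundles of the unregistered voters. -/
def encode : List ℕ :=
  [I.m, I.nV, I.nW, (I.p : ℕ), I.k]
    ++ (List.finRange I.nV).flatMap (fun v => encodePref (I.regPref v))
    ++ (List.finRange I.nW).flatMap (fun w => encodePref (I.unregPref w))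
    ++ (List.finRange I.nW).flatMap (fun w => encodeBundle (I.bundle w))

end CCCAV

/-! The swap distance counts inversions (`swapDist_eq_card_inversions`). Along a single-crossing
order each pair of alternatives changes sides at most once, so this distance is additive
(`PrefOrder.swapDist_add`). The distances from a voter that is farthest from some fixed voter are
then coordinates on a line that realize all swap distances (`dist_eq_of_farthest`,
`SingleCrossing.isCoordinate`). They are computed from the preference orders alone, so no
single-crossing order has to be searched for.

In these coordinates a full-d bundle consists of the unregistered voters within d of its leader. A
bundle between two others contains their intersection, so when leaders are added from left to right,
each one contributes exactly the members missing from the bundle of its predecessor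
(`coverage_insert`). A set of leaders is summarized by its size, its last and first element and up
to three counters, all small, and dynamic programming lists the attainable summaries
(`reach_chain_iff`).

For Condorcet's rule, the voters with p on top form an interval of the line. With at least two
alternatives, p wins if and only if neither the voters to the left of that interval nor those to the
right make up half of the electorate (`IsCoordinate.mem_condorcetRule_iff`), so three counters
decide. For Plurality, in a solution of minimum size every bundle except the first and the last
contains only supporters of p (`exists_plurality_chain`). The scores of the rivals then depend on
the two extreme leaders only, and one counter suffices.

On the machine side, everything is expressed by terms with sums bounded by the number of input
entries. Such terms compile to programs of polynomial running time (`Term.compile_exec`), and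
layered reachability under a relation given by a term can be tabulated (`exists_reach_table`). One
table locates the bundles in the input, a second one holds the chains of leaders. -/

/-! ## Terms with bounded sums and their compilation -/

namespace RAM

/-- What a term can read: the bound of its sums and the arrays. -/
structure Mem where
  size : ℕ
  arr : ℕ → ℕ → ℕ

/-- The part of a state that terms can read. -/
def State.mem (s : State) : Mem := ⟨s.reg 0, s.arr⟩

/-- Prepend a value to an environment. -/
def push (i : ℕ) (ρ : ℕ → ℕ) : ℕ → ℕ
  | 0 => i
  | k + 1 => ρ k

/-- Numerical terms with variables as de Bruijn indices; `sum t` binds a variable that ranges over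
the numbers below `size`. -/
inductive Term where
  | lit (n : ℕ) : Term
  | var (i : ℕ) : Term
  | get (a : ℕ) (t : Term) : Term
  | add (t u : Term) : Term
  | sub (t u : Term) : Term
  | ite (c t u : Term) : Term
  | sum (t : Term) : Term

/-- The value of a term. -/
def Term.eval (μ : Mem) : Term → (ℕ → ℕ) → ℕ
  | .lit n, _ => n
  | .var i, ρ => ρ i
  | .get a t, ρ => μ.arr a (t.eval μ ρ)
  | .add t u, ρ => t.eval μ ρ + u.eval μ ρ
  | .sub t u, ρ => t.eval μ ρ - u.eval μ ρ
  | .ite c t u, ρ => if c.eval μ ρ ≠ 0 then t.eval μ ρ else u.eval μ ρ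
  | .sum t, ρ => ∑ i ∈ Finset.range μ.size, t.eval μ (push i ρ)

/-- A program that computes a term into register `d`, using only the registers from `d` on. The
variables are read from the registers given by `e`. -/
def Term.compile : Term → (ℕ → ℕ) → ℕ → Program
  | .lit n, _, d => .assign d (.lit n)
  | .var i, e, d => .assign d (.reg (e i))
  | .get a t, e, d => .seq (t.compile e d) (.assign d (.get a (.reg d)))
  | .add t u, e, d =>
    .seq (t.compile e d) (.seq (u.compile e (d + 1)) (.assign d (.add (.reg d) (.reg (d + 1)))))
  | .sub t u, e, d =>
    .seq (t.compile e d) (.seq (u.compile e (d + 1)) (.assign d (.sub (.reg d) (.reg (d + 1)))))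
  | .ite c t u, e, d => .seq (c.compile e d) (.cond (.reg d) (t.compile e d) (u.compile e d))
  -- Register `d` accumulates the sum, `d + 1` is the bound variable, and the summand is computed
  -- from `d + 2` on.
  | .sum t, e, d =>
    .seq (.assign d (.lit 0)) (.seq (.assign (d + 1) (.lit 0))
      (.loop (.sub (.reg 0) (.reg (d + 1)))
        (.seq (.seq (t.compile (push (d + 1) e) (d + 2)) (.assign d (.add (.reg d) (.reg (d + 2)))))
          (.assign (d + 1) (.add (.reg (d + 1)) (.lit 1))))))

open Polynomial in
/-- A bound for the running time of the compiled term, as a polynomial in `size`. -/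
noncomputable def Term.bound : Term → Polynomial ℕ
  | .lit _ => 2
  | .var _ => 2
  | .get _ t => t.bound + 3
  | .add t u => t.bound + u.bound + 4
  | .sub t u => t.bound + u.bound + 4
  | .ite c t u => c.bound + 2 + t.bound + u.bound
  | .sum t => 4 + (X * (t.bound + 12) + 4)

theorem Exec.cast {P : Program} {s s' s₂ : State} {t : ℕ} (h : Exec P s t s') (hs : s' = s₂) :
    Exec P s t s₂ := hs ▸ h

/-- Counting loops: an invariant that every round preserves within time `B` holds at the end. -/
theorem exec_for {x : ℕ} {P : Program} {N B : ℕ} (Inv : ℕ → State → Prop)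
    (hx : ∀ i s, Inv i s → s.reg 0 = N ∧ s.reg x = i)
    (hstep : ∀ i < N, ∀ s, Inv i s → ∃ t s', Exec P s t s' ∧ t ≤ B ∧ s'.reg x = i ∧
      Inv (i + 1) (s'.setReg x (i + 1))) :
    ∀ n i, i + n = N → ∀ s, Inv i s → ∃ t s',
      Exec (.loop (.sub (.reg 0) (.reg x)) (.seq P (.assign x (.add (.reg x) (.lit 1))))) s t s' ∧
      t ≤ n * (B + 8) + 4 ∧ Inv N s' := by
  intro n
  induction n with
  | zero =>
    intro i hi s hs
    obtain ⟨h0, hxi⟩ := hx i s hs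
    refine ⟨_, s, Exec.loop_false ?_, ?_, ?_⟩
    · simp [Expr.eval, h0, hxi]; omega
    · simp [Expr.cost]
    · rwa [show N = i by omega]
  | succ n ih =>
    intro i hi s hs
    obtain ⟨h0, hxi⟩ := hx i s hs
    obtain ⟨t, s', he, ht, hr, hinv⟩ := hstep i (by omega) s hs
    obtain ⟨t₂, s₂, he₂, ht₂, hinv₂⟩ := ih (i + 1) (by omega) _ hinv
    refine ⟨_, s₂, Exec.loop_true ?_ (Exec.seq he (Exec.cast (Exec.assign x _ s') ?_)) he₂, ?_, hinv₂⟩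
    · simp [Expr.eval, h0, hxi]; omega
    · simp [Expr.eval, hr]
    -- Testing the condition and incrementing the counter cost 4 steps each, whence the 8 per round;
    -- the last, failing test costs the final 4.
    · simp only [Expr.cost]; nlinarith

theorem push_reg (s : State) (e : ℕ → ℕ) (x : ℕ) :
    (fun i => s.reg (push x e i)) = push (s.reg x) fun i => s.reg (e i) := by
  funext i; cases i <;> rfl

/-- Induction on the term. Since registers below `d` survive, so do the variables, and so does
register `0`, the range of the sums; a second subterm can thus be evaluated after the first. -/
theorem Term.compile_exec (t : Term) : ∀ (e : ℕ → ℕ) (d : ℕ) (s : State), 0 < d → (∀ i, e i < d) →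
    ∃ k s', Exec (t.compile e d) s k s' ∧ k ≤ t.bound.eval (s.reg 0) ∧ s'.arr = s.arr ∧
      s'.reg d = t.eval s.mem (fun i => s.reg (e i)) ∧ ∀ r < d, s'.reg r = s.reg r := by
  induction t with
  | lit n =>
    intro e d s hd he
    refine ⟨_, _, Exec.assign _ _ _, ?_, rfl, ?_, ?_⟩
    · simp [Expr.cost, bound]
    · simp [State.setReg, Expr.eval, Term.eval]
    · intro r hr; simp [State.setReg, hr.ne]
  | var n =>
    intro e d s hd he
    refine ⟨_, _, Exec.assign _ _ _, ?_, rfl, ?_, ?_⟩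
    · simp [Expr.cost, bound]
    · simp [State.setReg, Expr.eval, Term.eval]
    · intro r hr; simp [State.setReg, hr.ne]
  | get a t ih =>
    intro e d s hd he
    obtain ⟨k, s₁, h₁, hk, ha, hv, hr⟩ := ih e d s hd he
    refine ⟨_, _, Exec.seq h₁ (Exec.assign _ _ _), ?_, ha, ?_, ?_⟩
    · simp [Expr.cost, bound]; omega
    · simp [State.setReg, Expr.eval, Term.eval, hv, ha, State.mem]
    · intro r hr'; simp [State.setReg, hr'.ne, hr r hr']
  | add t u iht ihu =>
    intro e d s hd he
    obtain ⟨k₁, s₁, h₁, hk₁, ha₁, hv₁, hr₁⟩ := iht e d s hd he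
    obtain ⟨k₂, s₂, h₂, hk₂, ha₂, hv₂, hr₂⟩ := ihu e (d + 1) s₁ (by omega)
      (fun i => (he i).trans d.lt_succ_self)
    have e0 : s₁.reg 0 = s.reg 0 := hr₁ 0 hd
    have em : s₁.mem = s.mem := by simp [State.mem, ha₁, e0]
    have ee : (fun i => s₁.reg (e i)) = fun i => s.reg (e i) := funext fun i => hr₁ _ (he i)
    rw [e0] at hk₂
    refine ⟨_, _, Exec.seq h₁ (Exec.seq h₂ (Exec.assign _ _ _)), ?_, ha₂.trans ha₁, ?_, ?_⟩
    · simp [Expr.cost, bound]; omega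
    · simp [State.setReg, Expr.eval, Term.eval, hv₂, hr₂ d, hv₁, em, ee]
    · intro r hr; simp [State.setReg, hr.ne, hr₂ r (by omega), hr₁ r hr]
  | sub t u iht ihu =>
    intro e d s hd he
    obtain ⟨k₁, s₁, h₁, hk₁, ha₁, hv₁, hr₁⟩ := iht e d s hd he
    obtain ⟨k₂, s₂, h₂, hk₂, ha₂, hv₂, hr₂⟩ := ihu e (d + 1) s₁ (by omega)
      (fun i => (he i).trans d.lt_succ_self)
    have e0 : s₁.reg 0 = s.reg 0 := hr₁ 0 hd
    have em : s₁.mem = s.mem := by simp [State.mem, ha₁, e0]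
    have ee : (fun i => s₁.reg (e i)) = fun i => s.reg (e i) := funext fun i => hr₁ _ (he i)
    rw [e0] at hk₂
    refine ⟨_, _, Exec.seq h₁ (Exec.seq h₂ (Exec.assign _ _ _)), ?_, ha₂.trans ha₁, ?_, ?_⟩
    · simp [Expr.cost, bound]; omega
    · simp [State.setReg, Expr.eval, Term.eval, hv₂, hr₂ d, hv₁, em, ee]
    · intro r hr; simp [State.setReg, hr.ne, hr₂ r (by omega), hr₁ r hr]
  | ite c t u ihc iht ihu =>
    intro e d s hd he
    obtain ⟨k₁, s₁, h₁, hk₁, ha₁, hv₁, hr₁⟩ := ihc e d s hd he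
    have e0 : s₁.reg 0 = s.reg 0 := hr₁ 0 hd
    have em : s₁.mem = s.mem := by simp [State.mem, ha₁, e0]
    have ee : (fun i => s₁.reg (e i)) = fun i => s.reg (e i) := funext fun i => hr₁ _ (he i)
    by_cases hc : c.eval s.mem (fun i => s.reg (e i)) = 0
    · obtain ⟨k₂, s₂, h₂, hk₂, ha₂, hv₂, hr₂⟩ := ihu e d s₁ hd he
      rw [e0] at hk₂
      refine ⟨_, _, Exec.seq h₁ (Exec.cond_false ?_ h₂), ?_, ha₂.trans ha₁, ?_, ?_⟩
      · simp [Expr.eval, hv₁, hc]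
      · simp [Expr.cost, bound]; omega
      · simp [Term.eval, hc, hv₂, em, ee]
      · intro r hr; rw [hr₂ r hr, hr₁ r hr]
    · obtain ⟨k₂, s₂, h₂, hk₂, ha₂, hv₂, hr₂⟩ := iht e d s₁ hd he
      rw [e0] at hk₂
      refine ⟨_, _, Exec.seq h₁ (Exec.cond_true ?_ h₂), ?_, ha₂.trans ha₁, ?_, ?_⟩
      · simp [Expr.eval, hv₁, hc]
      · simp [Expr.cost, bound]; omega
      · simp [Term.eval, hc, hv₂, em, ee]
      · intro r hr; rw [hr₂ r hr, hr₁ r hr]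
  | sum t ih =>
    intro e d s hd he
    -- The invariant says that register `d` holds the partial sum; the extra 4 pays for the addition
    -- to it.
    have hloop := exec_for (x := d + 1) (N := s.reg 0) (B := t.bound.eval (s.reg 0) + 4)
      (P := .seq (t.compile (push (d + 1) e) (d + 2)) (.assign d (.add (.reg d) (.reg (d + 2)))))
      (fun i s' => s'.reg (d + 1) = i ∧ s'.arr = s.arr ∧ (∀ r < d, s'.reg r = s.reg r) ∧
        s'.reg d = ∑ j ∈ Finset.range i, t.eval s.mem (push j fun i => s.reg (e i)))
      (fun i s' h => ⟨h.2.2.1 0 hd, h.1⟩)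
      (by
        rintro i hi s₁ ⟨hx, ha, hr, hs⟩
        have e0 : s₁.reg 0 = s.reg 0 := hr 0 hd
        have em : s₁.mem = s.mem := by simp [State.mem, ha, e0]
        have ee : (fun i => s₁.reg (e i)) = fun i => s.reg (e i) := funext fun i => hr _ (he i)
        obtain ⟨k₂, s₂, h₂, hk₂, ha₂, hv₂, hr₂⟩ := ih (push (d + 1) e) (d + 2) s₁ (by omega)
          (by rintro (_ | i)
              · simp [push]
              · exact (he i).trans (by omega))
        rw [e0] at hk₂
        rw [push_reg, em, ee, hx] at hv₂
        refine ⟨_, _, Exec.seq h₂ (Exec.assign _ _ _), ?_, ?_, ?_, ?_, ?_, ?_⟩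
        · simp [Expr.cost]; omega
        · simp [State.setReg, hr₂ (d + 1), hx]
        · simp [State.setReg]
        · simp [State.setReg, ha₂, ha]
        · intro r hr'
          have h1 : r ≠ d + 1 := by omega
          simp [State.setReg, h1, hr'.ne, hr₂ r (by omega), hr r hr']
        · simp [State.setReg, Expr.eval, hr₂ d, hs, hv₂, Finset.sum_range_succ])
      (s.reg 0) 0 (by simp) ((s.setReg d 0).setReg (d + 1) 0)
      ⟨by simp [State.setReg], rfl, fun r hr => by
        have h1 : r ≠ d + 1 := by omega
        simp [State.setReg, h1, hr.ne], by simp [State.setReg]⟩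
    obtain ⟨k, s', h, hk, hx, ha, hr, hs⟩ := hloop
    refine ⟨_, s', Exec.seq (Exec.assign _ _ _) (Exec.seq (Exec.assign _ _ _) h), ?_, ha, ?_, hr⟩
    · simp [Expr.cost, bound]; linarith
    · simpa [Term.eval, State.mem] using hs

/-! ## Filling tables -/

/-- Fill array `a` at the consecutive indices counted by register `1` with the values of `t`, where
`D` further variables run through all numbers below `size`, the last one fastest. -/
def fill (a : ℕ) (t : Term) : ℕ → (ℕ → ℕ) → ℕ → Program
  | 0, e, d => .seq (t.compile e d)
      (.seq (.write a (.reg 1) (.reg d)) (.assign 1 (.add (.reg 1) (.lit 1))))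
  | D + 1, e, d => .seq (.assign d (.lit 0)) (.loop (.sub (.reg 0) (.reg d))
      (.seq (fill a t D (push d e) (d + 1)) (.assign d (.add (.reg d) (.lit 1)))))

open Polynomial in
/-- A bound for the running time of `fill`. -/
noncomputable def fillBound (t : Term) : ℕ → Polynomial ℕ
  | 0 => t.bound + 7
  | D + 1 => 2 + (X * (fillBound t D + 8) + 4)

/-- The term `t` computes the entry `G c` of array `a` from the entries before it, for all `c` that
arise from `c₀` by choosing the last `D` variables. -/
def Computes (μ : Mem) (a : ℕ) (t : Term) (G : ℕ → ℕ) : ℕ → (ℕ → ℕ) → ℕ → Prop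
  | 0, ρ, c => ∀ A : ℕ → ℕ → ℕ, (∀ b ≠ a, A b = μ.arr b) → (∀ i < c, A a i = G i) →
      t.eval ⟨μ.size, A⟩ ρ = G c
  | D + 1, ρ, c => ∀ x < μ.size, Computes μ a t G D (push x ρ) (c + x * μ.size ^ D)

/-- Induction on the number of nested loops. The write position in register `1` is never reset, so
`D` loops write `size ^ D` consecutive entries in lexicographic order, and all entries before the
current one are already correct. Variables must not live in register `1`, because it changes. -/
theorem fill_exec (μ : Mem) (a : ℕ) (t : Term) (G : ℕ → ℕ) (D : ℕ) :
    ∀ (e : ℕ → ℕ) (d : ℕ) (s : State) (c : ℕ), 1 < d → (∀ i, e i < d) → (∀ i, e i ≠ 1) →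
      s.reg 0 = μ.size → s.reg 1 = c → (∀ b ≠ a, s.arr b = μ.arr b) → (∀ i < c, s.arr a i = G i) →
      Computes μ a t G D (fun i => s.reg (e i)) c →
      ∃ k s', Exec (fill a t D e d) s k s' ∧ k ≤ (fillBound t D).eval μ.size ∧
        s'.reg 1 = c + μ.size ^ D ∧ (∀ b ≠ a, s'.arr b = μ.arr b) ∧
        (∀ i < c + μ.size ^ D, s'.arr a i = G i) ∧ ∀ r < d, r ≠ 1 → s'.reg r = s.reg r := by
  induction D with
  | zero =>
    intro e d s c hd he he1 h0 h1 hb hG hC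
    obtain ⟨k, s₁, hex, hk, ha, hv, hr⟩ := t.compile_exec e d s (by omega) he
    have hval : s₁.reg d = G c := by
      rw [hv, State.mem, h0]; exact hC s.arr hb hG
    have hr1 : s₁.reg 1 = c := by rw [hr 1 hd, h1]
    refine ⟨_, _, Exec.seq hex (Exec.seq (Exec.write _ _ _ _) (Exec.assign _ _ _)), ?_, ?_, ?_, ?_, ?_⟩
    · rw [h0] at hk; simp [Expr.cost, fillBound]; omega
    · simp [State.setReg, State.setArr, Expr.eval, hr1]
    · intro b hb'
      simp [State.setReg, State.setArr, hb', ha, hb b hb']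
    · intro i hi
      simp only [State.setReg, State.setArr, Expr.eval, hr1, hval, Function.update_self]
      rcases eq_or_ne i c with rfl | hic
      · simp
      · simp only [pow_zero] at hi
        rw [Function.update_of_ne hic, ha]; exact hG i (by omega)
    · intro r hr' hr1'
      simp [State.setReg, State.setArr, hr1', hr r hr']
  | succ D ih =>
    intro e d s c hd he he1 h0 h1 hb hG hC
    have hloop := exec_for (x := d) (N := μ.size) (B := (fillBound t D).eval μ.size)
      (P := fill a t D (push d e) (d + 1))
      (fun i s' => s'.reg d = i ∧ s'.reg 1 = c + i * μ.size ^ D ∧ (∀ b ≠ a, s'.arr b = μ.arr b) ∧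
        (∀ j < c + i * μ.size ^ D, s'.arr a j = G j) ∧ ∀ r < d, r ≠ 1 → s'.reg r = s.reg r)
      (fun i s' h => ⟨by rw [h.2.2.2.2 0 (by omega) (by omega), h0], h.1⟩)
      (by
        rintro i hi s₁ ⟨hx, h1', hb', hG', hr'⟩
        have ee : (fun i => s₁.reg (e i)) = fun i => s.reg (e i) :=
          funext fun i => hr' _ (he i) (he1 i)
        obtain ⟨k, s₂, hex, hk, h1'', hb'', hG'', hr''⟩ := ih (push d e) (d + 1) s₁ _ (by omega)
          (by rintro (_ | i)
              · simp [push]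
              · exact (he i).trans (by omega))
          (by rintro (_ | i)
              · simp only [push]; omega
              · exact he1 i)
          (by rw [hr' 0 (by omega) (by omega), h0]) h1' hb' hG'
          (by rw [push_reg, hx, ee]; exact hC i hi)
        refine ⟨k, s₂, hex, hk, by rw [hr'' d (by omega) (by omega), hx], ?_, ?_, ?_, ?_, ?_⟩
        · simp [State.setReg]
        · have : (1 : ℕ) ≠ d := by omega
          simp only [State.setReg, Function.update_of_ne this, h1'']; ring
        · exact hb''
        · intro j hj; exact hG'' j (by rw [add_assoc, ← Nat.succ_mul]; exact hj)
        · intro r hr1 hr2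
          simp only [State.setReg, Function.update_of_ne hr1.ne]
          rw [hr'' r (by omega) hr2, hr' r hr1 hr2])
      μ.size 0 (by simp) (s.setReg d 0)
      ⟨by simp [State.setReg], by simp [State.setReg, (show (1 : ℕ) ≠ d by omega), h1], hb,
        fun j hj => hG j (by simpa using hj), fun r hr _ => by simp [State.setReg, hr.ne]⟩
    obtain ⟨k, s', h, hk, -, h1', hb', hG', hr'⟩ := hloop
    refine ⟨_, s', Exec.seq (Exec.assign _ _ _) h, ?_, ?_, hb', ?_, hr'⟩
    · simp [Expr.cost, fillBound]; linarith
    · rw [h1', pow_succ, mul_comm (μ.size ^ D)]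
    · rwa [pow_succ, mul_comm (μ.size ^ D)]

end RAM

/-! ## Computable functions and predicates -/

namespace RAM

/-- The number `1` if `p` holds and `0` otherwise. -/
noncomputable def ind (p : Prop) : ℕ :=
  open Classical in if p then 1 else 0

theorem ind_of {p : Prop} (h : p) : ind p = 1 := if_pos h

theorem ind_of_not {p : Prop} (h : ¬ p) : ind p = 0 := if_neg h

theorem ind_ne_zero {p : Prop} : ind p ≠ 0 ↔ p := by
  by_cases h : p <;> simp [ind, h]

theorem ind_congr {p q : Prop} (h : p ↔ q) : ind p = ind q := by rw [propext h]

/-- The function `f` of the memory and the environment is given by a term. -/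
def Comp (f : Mem → (ℕ → ℕ) → ℕ) : Prop :=
  ∃ t : Term, ∀ μ ρ, t.eval μ ρ = f μ ρ

/-- The indicator of the predicate `p` on the memory and the environment is given by a term. -/
def CompP (p : Mem → (ℕ → ℕ) → Prop) : Prop :=
  Comp fun μ ρ => ind (p μ ρ)

/-- Rename the variables of a term. -/
def Term.rename : Term → (ℕ → ℕ) → Term
  | .lit n, _ => .lit n
  | .var i, r => .var (r i)
  | .get a t, r => .get a (t.rename r)
  | .add t u, r => .add (t.rename r) (u.rename r)
  | .sub t u, r => .sub (t.rename r) (u.rename r)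
  | .ite c t u, r => .ite (c.rename r) (t.rename r) (u.rename r)
  | .sum t, r => .sum (t.rename (push 0 fun i => r i + 1))

theorem Term.eval_rename (μ : Mem) (t : Term) : ∀ (r ρ : ℕ → ℕ),
    (t.rename r).eval μ ρ = t.eval μ fun i => ρ (r i) := by
  induction t with
  | sum t ih =>
    intro r ρ
    simp only [rename, eval, ih]
    refine Finset.sum_congr rfl fun i _ => ?_
    congr 1
    funext j; cases j <;> rfl
  | _ => simp_all [rename, eval]

/-! ### Closure properties of computable functions and predicates -/

namespace Comp

variable {f g : Mem → (ℕ → ℕ) → ℕ} {p : Mem → (ℕ → ℕ) → Prop}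

theorem congr (hf : Comp f) (h : ∀ μ ρ, f μ ρ = g μ ρ) : Comp g :=
  (funext fun μ => funext fun ρ => h μ ρ : f = g) ▸ hf

theorem rename (hf : Comp f) (r : ℕ → ℕ) : Comp fun μ ρ => f μ fun i => ρ (r i) :=
  let ⟨t, ht⟩ := hf
  ⟨t.rename r, fun μ ρ => by rw [Term.eval_rename, ht]⟩

theorem weaken (hf : Comp f) : Comp fun μ ρ => f μ fun i => ρ (i + 1) := hf.rename _

theorem lit (n : ℕ) : Comp fun _ _ => n := ⟨.lit n, fun _ _ => rfl⟩

theorem var (i : ℕ) : Comp fun _ ρ => ρ i := ⟨.var i, fun _ _ => rfl⟩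

theorem get (a : ℕ) (hf : Comp f) : Comp fun μ ρ => μ.arr a (f μ ρ) :=
  let ⟨t, ht⟩ := hf
  ⟨.get a t, fun μ ρ => by simp [Term.eval, ht]⟩

theorem add (hf : Comp f) (hg : Comp g) : Comp fun μ ρ => f μ ρ + g μ ρ :=
  let ⟨t, ht⟩ := hf
  let ⟨u, hu⟩ := hg
  ⟨.add t u, fun μ ρ => by simp [Term.eval, ht, hu]⟩

theorem sub (hf : Comp f) (hg : Comp g) : Comp fun μ ρ => f μ ρ - g μ ρ :=
  let ⟨t, ht⟩ := hf
  let ⟨u, hu⟩ := hg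
  ⟨.sub t u, fun μ ρ => by simp [Term.eval, ht, hu]⟩

theorem ind_mul (hp : CompP p) (hf : Comp f) : Comp fun μ ρ => ind (p μ ρ) * f μ ρ :=
  let ⟨t, ht⟩ := hp
  let ⟨u, hu⟩ := hf
  ⟨.ite t u (.lit 0), fun μ ρ => by
    by_cases h : p μ ρ <;> simp [Term.eval, ht, hu, ind, h]⟩

theorem sum {g : Mem → ℕ → (ℕ → ℕ) → ℕ} (hg : Comp fun μ ρ => g μ (ρ 0) fun i => ρ (i + 1)) :
    Comp fun μ ρ => ∑ i ∈ Finset.range μ.size, g μ i ρ :=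
  let ⟨t, ht⟩ := hg
  ⟨.sum t, fun μ ρ => by simp [Term.eval, ht, push]⟩

/-- Terms have no multiplication, but a constant summed over the full range is a product with
`size`. This is what positional notation in base `size` needs. -/
theorem mul_size (hf : Comp f) : Comp fun μ ρ => f μ ρ * μ.size :=
  (Comp.sum (g := fun μ _ ρ => f μ ρ) hf.weaken).congr fun μ ρ => by simp [mul_comm]

end Comp

namespace CompP

variable {f g : Mem → (ℕ → ℕ) → ℕ} {p q : Mem → (ℕ → ℕ) → Prop}

theorem lt (hf : Comp f) (hg : Comp g) : CompP fun μ ρ => f μ ρ < g μ ρ :=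
  let ⟨t, ht⟩ := hf
  let ⟨u, hu⟩ := hg
  ⟨.ite (.sub u t) (.lit 1) (.lit 0), fun μ ρ => by
    by_cases h : f μ ρ < g μ ρ
    · simp [Term.eval, ht, hu, ind, h, Nat.sub_eq_zero_iff_le]
    · simp [Term.eval, ht, hu, ind, h, not_lt.1 h]⟩

theorem not (hp : CompP p) : CompP fun μ ρ => ¬ p μ ρ :=
  let ⟨t, ht⟩ := hp
  ⟨.ite t (.lit 0) (.lit 1), fun μ ρ => by by_cases h : p μ ρ <;> simp [Term.eval, ht, ind, h]⟩

theorem and (hp : CompP p) (hq : CompP q) : CompP fun μ ρ => p μ ρ ∧ q μ ρ :=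
  let ⟨t, ht⟩ := hp
  let ⟨u, hu⟩ := hq
  ⟨.ite t u (.lit 0), fun μ ρ => by
    by_cases h : p μ ρ <;> by_cases h' : q μ ρ <;> simp [Term.eval, ht, hu, ind, h, h']⟩

theorem congr (hp : CompP p) (h : ∀ μ ρ, p μ ρ ↔ q μ ρ) : CompP q :=
  Comp.congr hp fun μ ρ => ind_congr (h μ ρ)

theorem or (hp : CompP p) (hq : CompP q) : CompP fun μ ρ => p μ ρ ∨ q μ ρ :=
  (hp.not.and hq.not).not.congr fun _ _ => by tauto

theorem imp (hp : CompP p) (hq : CompP q) : CompP fun μ ρ => p μ ρ → q μ ρ :=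
  (hp.and hq.not).not.congr fun _ _ => by tauto

theorem le (hf : Comp f) (hg : Comp g) : CompP fun μ ρ => f μ ρ ≤ g μ ρ :=
  (lt hg hf).not.congr fun _ _ => not_lt

theorem eq (hf : Comp f) (hg : Comp g) : CompP fun μ ρ => f μ ρ = g μ ρ :=
  ((le hf hg).and (le hg hf)).congr fun _ _ => le_antisymm_iff.symm

/-- A sum of indicators is nonzero exactly when one of them is, so bounded sums provide bounded
quantifiers. -/
theorem ex {p : Mem → ℕ → (ℕ → ℕ) → Prop} (hp : CompP fun μ ρ => p μ (ρ 0) fun i => ρ (i + 1)) :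
    CompP fun μ ρ => ∃ i < μ.size, p μ i ρ :=
  (CompP.not (CompP.eq (Comp.sum (g := fun μ i ρ => ind (p μ i ρ)) hp) (Comp.lit 0))).congr
    fun μ ρ => by
      rw [Finset.sum_eq_zero_iff]
      simp only [Finset.mem_range, not_forall, exists_prop, ← ne_eq, ind_ne_zero]

theorem all {p : Mem → ℕ → (ℕ → ℕ) → Prop} (hp : CompP fun μ ρ => p μ (ρ 0) fun i => ρ (i + 1)) :
    CompP fun μ ρ => ∀ i < μ.size, p μ i ρ :=
  (ex (p := fun μ i ρ => ¬ p μ i ρ) hp.not).not.congr fun μ ρ => by simp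

end CompP

/-! ## Layered reachability -/

/-- Reachability in exactly `j` steps within the states all of whose entries are below `N`. -/
def Reach (N : ℕ) (init : ℕ → ℕ → ℕ → ℕ → ℕ → Prop)
    (step : ℕ → ℕ → ℕ → ℕ → ℕ → ℕ → ℕ → ℕ → ℕ → ℕ → Prop) : ℕ → ℕ → ℕ → ℕ → ℕ → ℕ → Prop
  | 0, x, y, a, b, c => init x y a b c
  | j + 1, x', y', a', b', c' => ∃ x < N, ∃ y < N, ∃ a < N, ∃ b < N, ∃ c < N,
      Reach N init step j x y a b c ∧ step x y a b c x' y' a' b' c'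

/-- The number with the digits `j, x, y, a, b, c` in base `N`. -/
def flat (N j x y a b c : ℕ) : ℕ := ((((j * N + x) * N + y) * N + a) * N + b) * N + c

/-- A larger leading digit outweighs everything after it. Hence each layer of a table lies entirely
before the next one. -/
theorem digit_lt {N a a' b b' : ℕ} (h : a < a') (hb : b < N) : a * N + b < a' * N + b' := by
  nlinarith

theorem digit_inj {N a a' b b' : ℕ} (hb : b < N) (hb' : b' < N) (h : a * N + b = a' * N + b') :
    a = a' ∧ b = b' := by
  rcases lt_trichotomy a a' with h' | rfl | h'
  · exact absurd h (digit_lt h' hb).ne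
  · exact ⟨rfl, by omega⟩
  · exact absurd h (digit_lt h' hb').ne'

theorem Comp.flat {j x y a b c : Mem → (ℕ → ℕ) → ℕ} (hj : Comp j) (hx : Comp x) (hy : Comp y)
    (ha : Comp a) (hb : Comp b) (hc : Comp c) :
    Comp fun μ ρ => flat μ.size (j μ ρ) (x μ ρ) (y μ ρ) (a μ ρ) (b μ ρ) (c μ ρ) :=
  ((((((((((hj.mul_size).add hx).mul_size).add hy).mul_size).add ha).mul_size).add hb).mul_size).add
    hc)

/-- Layered reachability for a computable relation can be tabulated. -/
theorem exists_reach_table (k : ℕ) {init : Mem → ℕ → ℕ → ℕ → ℕ → ℕ → Prop}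
    {step : Mem → ℕ → ℕ → ℕ → ℕ → ℕ → ℕ → ℕ → ℕ → ℕ → ℕ → Prop}
    (hinit : CompP fun μ ρ => init μ (ρ 4) (ρ 3) (ρ 2) (ρ 1) (ρ 0))
    (hstep : CompP fun μ ρ =>
      step μ (ρ 4) (ρ 3) (ρ 2) (ρ 1) (ρ 0) (ρ 9) (ρ 8) (ρ 7) (ρ 6) (ρ 5))
    (hi : ∀ N A A', (∀ b ≠ k, A b = A' b) → init ⟨N, A⟩ = init ⟨N, A'⟩)
    (hs : ∀ N A A', (∀ b ≠ k, A b = A' b) → step ⟨N, A⟩ = step ⟨N, A'⟩) :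
    ∃ (P : Program) (T : Polynomial ℕ), ∀ μ s, s.reg 0 = μ.size → (∀ b ≠ k, s.arr b = μ.arr b) →
      ∃ t s', Exec P s t s' ∧ t ≤ T.eval μ.size ∧ s'.reg 0 = μ.size ∧
        (∀ b ≠ k, s'.arr b = μ.arr b) ∧
        ∀ j < μ.size, ∀ x < μ.size, ∀ y < μ.size, ∀ a < μ.size, ∀ b < μ.size, ∀ c < μ.size,
          s'.arr k (flat μ.size j x y a b c) =
            ind (Reach μ.size (init μ) (step μ) j x y a b c) := by
  -- Variables 5 to 0 are the digits of the entry, the layer first. An entry of a positive layer is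
  -- found by looking up its possible predecessors in the layer before, in the table itself.
  have hentry : CompP fun μ ρ => (ρ 5 = 0 ∧ init μ (ρ 4) (ρ 3) (ρ 2) (ρ 1) (ρ 0)) ∨ (0 < ρ 5 ∧
      ∃ x < μ.size, ∃ y < μ.size, ∃ a < μ.size, ∃ b < μ.size, ∃ c < μ.size,
        μ.arr k (flat μ.size (ρ 5 - 1) x y a b c) ≠ 0 ∧
        step μ x y a b c (ρ 4) (ρ 3) (ρ 2) (ρ 1) (ρ 0)) := by
    refine .or (.and (.eq (.var 5) (.lit 0)) hinit) (.and (.lt (.lit 0) (.var 5)) ?_)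
    refine .ex (.ex (.ex (.ex (.ex (.and (.not (.eq (.get k ?_) (.lit 0))) hstep)))))
    exact .flat (.sub (.var 10) (.lit 1)) (.var 4) (.var 3) (.var 2) (.var 1) (.var 0)
  obtain ⟨t, ht⟩ := hentry
  refine ⟨.seq (.assign 1 (.lit 0)) (fill k t 6 (fun _ => 0) 2), 2 + fillBound t 6,
    fun μ s h0 hb => ?_⟩
  set N := μ.size with hN
  let R := Reach N (init μ) (step μ)
  -- The intended table as a function of a plain index; the digits of an index are unique by
  -- `digit_inj`.
  let G : ℕ → ℕ := fun i => ind (∃ j x y a b c, x < N ∧ y < N ∧ a < N ∧ b < N ∧ c < N ∧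
    i = flat N j x y a b c ∧ R j x y a b c)
  have hG : ∀ j, ∀ x < N, ∀ y < N, ∀ a < N, ∀ b < N, ∀ c < N,
      G (flat N j x y a b c) = ind (R j x y a b c) := by
    intro j x hx y hy a ha b hb c hc
    refine ind_congr ⟨?_, fun h => ⟨j, x, y, a, b, c, hx, hy, ha, hb, hc, rfl, h⟩⟩
    rintro ⟨j', x', y', a', b', c', hx', hy', ha', hb', hc', h, hR⟩
    obtain ⟨h₁, rfl⟩ := digit_inj hc hc' h
    obtain ⟨h₂, rfl⟩ := digit_inj hb hb' h₁
    obtain ⟨h₃, rfl⟩ := digit_inj ha ha' h₂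
    obtain ⟨h₄, rfl⟩ := digit_inj hy hy' h₃
    obtain ⟨rfl, rfl⟩ := digit_inj hx hx' h₄
    exact hR
  have hcomp : Computes μ k t G 6 (fun _ => s.reg 0) 0 := by
    intro j hj x hx y hy a ha b hb c hc A hA hAG
    have hidx : 0 + j * μ.size ^ 5 + x * μ.size ^ 4 + y * μ.size ^ 3 + a * μ.size ^ 2 +
        b * μ.size ^ 1 + c * μ.size ^ 0 = flat N j x y a b c := by
      simp only [flat, hN]; ring
    rw [hidx] at hAG ⊢
    rw [hG j x hx y hy a ha b hb c hc, ht]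
    refine ind_congr ?_
    simp only [push]
    -- The relations do not read array `k`, so they are the same whatever part of the table has been
    -- written.
    rw [hi μ.size A μ.arr hA, hs μ.size A μ.arr hA]
    cases j with
    | zero => simp [R, Reach]
    | succ j =>
      simp only [Nat.succ_ne_zero, false_and, Nat.zero_lt_succ, true_and, false_or,
        Nat.add_sub_cancel, R, Reach]
      have key : ∀ x' < N, ∀ y' < N, ∀ a' < N, ∀ b' < N, ∀ c' < N,
          (A k (flat μ.size j x' y' a' b' c') ≠ 0 ↔ R j x' y' a' b' c') := by
        intro x' hx' y' hy' a' ha' b' hb' c' hc'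
        rw [hAG (flat N j x' y' a' b' c') (digit_lt (digit_lt (digit_lt (digit_lt (digit_lt j.lt_succ_self hx') hy') ha')
          hb') hc'), hG j x' hx' y' hy' a' ha' b' hb' c' hc', ind_ne_zero]
      constructor
      · rintro ⟨x', hx', y', hy', a', ha', b', hb', c', hc', h, h'⟩
        exact ⟨x', hx', y', hy', a', ha', b', hb', c', hc',
          (key x' hx' y' hy' a' ha' b' hb' c' hc').1 h, h'⟩
      · rintro ⟨x', hx', y', hy', a', ha', b', hb', c', hc', h, h'⟩
        exact ⟨x', hx', y', hy', a', ha', b', hb', c', hc',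
          (key x' hx' y' hy' a' ha' b' hb' c' hc').2 h, h'⟩
  obtain ⟨n, s', hex, hn, -, hb', hG', hr⟩ := fill_exec μ k t G 6 (fun _ => 0) 2 (s.setReg 1 0) 0
    (by omega) (by simp) (by simp) (by simp [State.setReg, h0, hN]) (by simp [State.setReg]) hb
    (by simp) (by simpa [State.setReg] using hcomp)
  refine ⟨_, s', .seq (.assign _ _ _) hex, ?_, ?_, hb', ?_⟩
  · simp [Expr.cost]; omega
  · rw [hr 0 (by omega) (by omega)]; simp [State.setReg, h0]
  · intro j hj x hx y hy a ha b hb c hc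
    rw [hG' _ ?_, hG j x hx y hy a ha b hb c hc]
    -- Comparison with the number whose leading digit is `N` and whose other digits are 0, which is
    -- `N ^ 6`.
    have := digit_lt (b' := 0) (digit_lt (b' := 0) (digit_lt (b' := 0) (digit_lt (b' := 0)
      (digit_lt (b' := 0) hj hx) hy) ha) hb) hc
    simp only [flat]
    refine this.trans_eq ?_
    ring

end RAM

/-! ## The swap distance -/

namespace PrefOrder

variable {m : ℕ}

/-- The pairs of alternatives that are ranked this way by the first order and the other way by the
second one. -/
def inversions (π ρ : PrefOrder m) : Finset (Fin m × Fin m) :=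
  {q | π.Prefers q.1 q.2 ∧ ρ.Prefers q.2 q.1}

theorem mem_inversions {π ρ : PrefOrder m} {q : Fin m × Fin m} :
    q ∈ inversions π ρ ↔ π.Prefers q.1 q.2 ∧ ρ.Prefers q.2 q.1 := by simp [inversions]

theorem prefers_of_not {π : PrefOrder m} {a b : Fin m} (h : ¬ π.Prefers a b) (hab : a ≠ b) :
    π.Prefers b a :=
  lt_of_le_of_ne (not_lt.1 h) fun e => hab (π.symm.injective e.symm)

/-- No position lies strictly between `i` and `i + 1`, so transposing the two reverses no other
pair. -/
theorem prefers_swap {ρ : PrefOrder m} {i : ℕ} (hi : i + 1 < m) {a b : Fin m}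
    (h : ρ.Prefers a b) (hab : ¬ (a = ρ ⟨i, Nat.lt_of_succ_lt hi⟩ ∧ b = ρ ⟨i + 1, hi⟩)) :
    PrefOrder.Prefers (ρ * Equiv.swap ⟨i, Nat.lt_of_succ_lt hi⟩ ⟨i + 1, hi⟩) a b := by
  obtain ⟨x, rfl⟩ := ρ.surjective a
  obtain ⟨y, rfl⟩ := ρ.surjective b
  set τ := Equiv.swap (⟨i, Nat.lt_of_succ_lt hi⟩ : Fin m) ⟨i + 1, hi⟩ with hτ
  have hsymm : ∀ z, (ρ * τ).symm (ρ z) = τ z := by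
    intro z; rw [Equiv.symm_apply_eq]; simp [hτ]
  simp only [Prefers, Equiv.symm_apply_apply, Equiv.apply_eq_iff_eq] at h hab
  simp only [Prefers, hsymm]
  rw [hτ, Equiv.swap_apply_def, Equiv.swap_apply_def]
  simp only [Fin.ext_iff, Fin.lt_def] at *
  split_ifs <;> (try simp only []) <;> omega

/-- Only the swapped pair can become a new inversion. This gives the lower bound on the number of
swaps, and also the progress of sorting by adjacent swaps. -/
theorem inversions_swap_subset (π ρ : PrefOrder m) {i : ℕ} (hi : i + 1 < m) :
    inversions π (ρ * Equiv.swap ⟨i, Nat.lt_of_succ_lt hi⟩ ⟨i + 1, hi⟩) ⊆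
      insert (ρ ⟨i, Nat.lt_of_succ_lt hi⟩, ρ ⟨i + 1, hi⟩) (inversions π ρ) := by
  rintro ⟨a, b⟩ h
  rw [Finset.mem_insert]
  rw [mem_inversions] at h
  by_contra hc
  rw [not_or] at hc
  have hne : a ≠ b := by rintro rfl; exact lt_irrefl _ h.1
  have h1 : ρ.Prefers a b := by
    by_contra h2
    exact hc.2 (mem_inversions.2 ⟨h.1, prefers_of_not h2 hne⟩)
  have := prefers_swap hi h1 fun e => hc.1 (by rw [e.1, e.2])
  exact lt_asymm this h.2

theorem card_inversions_le {n : ℕ} {π ρ : PrefOrder m} (h : SwapSteps n π ρ) :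
    (inversions π ρ).card ≤ n := by
  induction h with
  | refl π =>
    refine (Finset.card_eq_zero.2 (Finset.eq_empty_of_forall_notMem fun q hq => ?_)).le
    rw [mem_inversions] at hq
    exact lt_asymm hq.1 hq.2
  | step i hi _ ih =>
    exact (Finset.card_le_card (inversions_swap_subset _ _ hi)).trans
      ((Finset.card_insert_le _ _).trans (Nat.succ_le_succ ih))

/-- The change of positions from `ρ` to `π` is strictly increasing on neighbours, hence an order
automorphism of a finite linear order, and the identity is the only one. -/
theorem eq_of_forall_prefers {π ρ : PrefOrder m}
    (h : ∀ (i : ℕ) (hi : i + 1 < m), π.Prefers (ρ ⟨i, Nat.lt_of_succ_lt hi⟩) (ρ ⟨i + 1, hi⟩)) :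
    π = ρ := by
  cases m with
  | zero => exact Subsingleton.elim _ _
  | succ m =>
    have hmono : StrictMono fun x => π.symm (ρ x) :=
      Fin.strictMono_iff_lt_succ.2 fun i => h i.1 (Nat.succ_lt_succ i.2)
    have hid : ∀ x, π.symm (ρ x) = x := by
      intro x
      have := Subsingleton.elim
        (hmono.orderIsoOfSurjective _ ((π.symm.surjective).comp ρ.surjective)) (OrderIso.refl _)
      exact congrArg (fun f : Fin (m + 1) ≃o Fin (m + 1) => f x) this
    ext x
    have := hid (ρ.symm (π x))
    simp only [Equiv.apply_symm_apply, Equiv.symm_apply_apply] at this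
    conv_rhs => rw [this]
    simp

/-- Bubble sort: unless the orders agree, some neighbours in `ρ` are inverted relative to `π`, and
swapping them removes this inversion without creating another. -/
theorem exists_swapSteps_le {π ρ : PrefOrder m} :
    ∃ n ≤ (inversions π ρ).card, SwapSteps n π ρ := by
  induction hn : (inversions π ρ).card using Nat.strong_induction_on generalizing ρ with
  | _ n ih =>
    by_cases hall : ∀ (i : ℕ) (hi : i + 1 < m),
        π.Prefers (ρ ⟨i, Nat.lt_of_succ_lt hi⟩) (ρ ⟨i + 1, hi⟩)
    · rw [eq_of_forall_prefers hall]
      exact ⟨0, Nat.zero_le _, .refl _⟩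
    · push Not at hall
      obtain ⟨i, hi, h⟩ := hall
      have hinv : π.Prefers (ρ ⟨i + 1, hi⟩) (ρ ⟨i, Nat.lt_of_succ_lt hi⟩) :=
        prefers_of_not (not_lt.2 h) fun e => by simpa [Fin.ext_iff] using ρ.injective e
      set τ := Equiv.swap (⟨i, Nat.lt_of_succ_lt hi⟩ : Fin m) ⟨i + 1, hi⟩ with hτ
      have hss : inversions π (ρ * τ) ⊂ inversions π ρ := by
        refine (Finset.ssubset_iff_of_subset fun q hq => ?_).2
          ⟨(ρ ⟨i + 1, hi⟩, ρ ⟨i, Nat.lt_of_succ_lt hi⟩), ?_, ?_⟩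
        · rcases Finset.mem_insert.1 (inversions_swap_subset π ρ hi hq) with rfl | h'
          · exact absurd (mem_inversions.1 hq).1 (lt_asymm hinv)
          · exact h'
        · rw [mem_inversions]
          refine ⟨hinv, ?_⟩
          simp [Prefers, Fin.lt_def]
        · rw [mem_inversions]
          intro h'
          have h2 := h'.2
          have e1 : (ρ * τ).symm (ρ ⟨i, Nat.lt_of_succ_lt hi⟩) = ⟨i + 1, hi⟩ := by
            rw [Equiv.symm_apply_eq]; simp [hτ]
          have e2 : (ρ * τ).symm (ρ ⟨i + 1, hi⟩) = ⟨i, Nat.lt_of_succ_lt hi⟩ := by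
            rw [Equiv.symm_apply_eq]; simp [hτ]
          simp [Prefers, e1, e2, Fin.lt_def] at h2
      obtain ⟨k, hk, hs⟩ := ih _ (hn ▸ Finset.card_lt_card hss) rfl
      refine ⟨k + 1, by have := Finset.card_lt_card hss; omega, ?_⟩
      -- Steps are appended at the target end: the induction hypothesis leads to `ρ * τ`, and one
      -- more swap leads back to `ρ`.
      have := SwapSteps.step i hi hs
      rwa [mul_assoc, ← hτ, Equiv.swap_mul_self, mul_one] at this

theorem _root_.swapDist_eq_card_inversions (π ρ : PrefOrder m) :
    swapDist π ρ = (inversions π ρ).card := by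
  obtain ⟨n, hn, hs⟩ := exists_swapSteps_le (π := π) (ρ := ρ)
  exact le_antisymm ((Nat.sInf_le hs).trans hn)
    (le_csInf ⟨n, hs⟩ fun k hk => card_inversions_le hk)

theorem swapDist_comm (π ρ : PrefOrder m) : swapDist π ρ = swapDist ρ π := by
  rw [swapDist_eq_card_inversions, swapDist_eq_card_inversions]
  refine Finset.card_bij (fun q _ => (q.2, q.1)) ?_ ?_ ?_
  · intro q hq
    rw [mem_inversions] at hq ⊢
    exact hq.symm
  · rintro ⟨a, b⟩ _ ⟨a', b'⟩ _ h
    simp_all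
  · rintro ⟨a, b⟩ hq
    exact ⟨(b, a), by rw [mem_inversions] at hq ⊢; exact hq.symm, rfl⟩

theorem inversions_subset_union (π ρ σ : PrefOrder m) :
    inversions π σ ⊆ inversions π ρ ∪ inversions ρ σ := by
  rintro ⟨a, b⟩ h
  rw [Finset.mem_union, mem_inversions, mem_inversions]
  rw [mem_inversions] at h
  have hne : a ≠ b := by rintro rfl; exact lt_irrefl _ h.1
  by_cases h' : ρ.Prefers a b
  · exact Or.inr ⟨h', h.2⟩
  · exact Or.inl ⟨h.1, prefers_of_not h' hne⟩

theorem swapDist_triangle (π ρ σ : PrefOrder m) :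
    swapDist π σ ≤ swapDist π ρ + swapDist ρ σ := by
  simp only [swapDist_eq_card_inversions]
  exact (Finset.card_le_card (inversions_subset_union π ρ σ)).trans (Finset.card_union_le _ _)

theorem eq_of_swapDist_eq_zero {π ρ : PrefOrder m} (h : swapDist π ρ = 0) : π = ρ := by
  have h' := Nat.sInf_mem (s := {n | SwapSteps n π ρ}) (exists_swapSteps π ρ)
  rw [show sInf {n | SwapSteps n π ρ} = 0 from h] at h'
  cases h'
  rfl

/-- Crossing at most once makes the swap distance additive. -/
theorem swapDist_add {π ρ σ : PrefOrder m}
    (h : ∀ a b, π.Prefers a b → σ.Prefers a b → ρ.Prefers a b) :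
    swapDist π σ = swapDist π ρ + swapDist ρ σ := by
  simp only [swapDist_eq_card_inversions]
  rw [← Finset.card_union_of_disjoint]
  · congr 1
    refine (inversions_subset_union π ρ σ).antisymm ?_
    rintro ⟨a, b⟩ hq
    rw [Finset.mem_union, mem_inversions, mem_inversions] at hq
    rw [mem_inversions]
    -- An inversion on one of the two legs persists over the whole way; otherwise `π` and `σ` would
    -- agree on the pair against `ρ`, contrary to `h`.
    rcases hq with ⟨h1, h2⟩ | ⟨h1, h2⟩
    · refine ⟨h1, ?_⟩
      by_contra h3
      have hne : a ≠ b := by rintro rfl; exact lt_irrefl _ h1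
      exact lt_asymm h2 (h a b h1 (prefers_of_not h3 hne.symm))
    · refine ⟨?_, h2⟩
      by_contra h3
      have hne : a ≠ b := by rintro rfl; exact lt_irrefl _ h1
      exact lt_asymm h1 (h b a (prefers_of_not h3 hne) h2)
  · rw [Finset.disjoint_left]
    rintro ⟨a, b⟩ h1 h2
    exact lt_asymm (mem_inversions.1 h1).2 (mem_inversions.1 h2).1

/-- Additivity of the swap distance makes the middle order agree with the outer ones. -/
theorem prefers_of_swapDist_add {π ρ σ : PrefOrder m}
    (h : swapDist π σ = swapDist π ρ + swapDist ρ σ) {a b : Fin m} (h1 : π.Prefers a b)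
    (h2 : σ.Prefers a b) : ρ.Prefers a b := by
  by_contra h3
  have hne : a ≠ b := by rintro rfl; exact lt_irrefl _ h1
  have h4 := prefers_of_not h3 hne
  simp only [swapDist_eq_card_inversions] at h
  have hmem : (a, b) ∈ (inversions π ρ) := mem_inversions.2 ⟨h1, h4⟩
  -- The pair is inverted on the way to `ρ` but not between `π` and `σ`. It is a wasted inversion,
  -- so the triangle inequality would be strict.
  have hsub : inversions π σ ⊆ (inversions π ρ).erase (a, b) ∪ inversions ρ σ := by
    intro q hq
    rcases Finset.mem_union.1 (inversions_subset_union π ρ σ hq) with h5 | h5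
    · refine Finset.mem_union_left _ (Finset.mem_erase.2 ⟨?_, h5⟩)
      rintro rfl
      exact lt_asymm h2 (mem_inversions.1 hq).2
    · exact Finset.mem_union_right _ h5
  have h6 := (Finset.card_le_card hsub).trans (Finset.card_union_le _ _)
  have h7 := Finset.card_erase_lt_of_mem hmem
  omega

theorem exists_isTop (π : PrefOrder m) (p : Fin m) : ∃ c, π.IsTop c := by
  have hm : 0 < m := p.pos
  exact ⟨π ⟨0, hm⟩, by rw [IsTop, Equiv.symm_apply_apply]⟩

theorem IsTop.prefers {π : PrefOrder m} {p c : Fin m} (h : π.IsTop p) (hc : c ≠ p) :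
    π.Prefers p c := by
  have hne : π.symm c ≠ π.symm p := fun e => hc (π.symm.injective e)
  rw [Prefers, Fin.lt_def, h]
  exact Nat.pos_of_ne_zero fun e => hne (Fin.ext (by rw [e, h]))

theorem IsTop.eq {π : PrefOrder m} {p c : Fin m} (h : π.IsTop p) (hc : π.IsTop c) : p = c :=
  π.symm.injective (Fin.ext (by rw [h, hc]))

end PrefOrder

/-! ### Coordinates on a line for single-crossing voters -/

/-- In a pseudometric that is additive along a linear order, the distances from a point that is
farthest from some other point determine all distances. -/
theorem dist_eq_of_farthest {X : Type} [LinearOrder X] {d : X → X → ℕ}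
    (hcomm : ∀ x y, d x y = d y x) (htri : ∀ x y z, d x z ≤ d x y + d y z)
    (hadd : ∀ x y z, x ≤ y → y ≤ z → d x z = d x y + d y z) {o e : X}
    (he : ∀ x, d o x ≤ d o e) (u v : X) : d u v = (d e u - d e v) + (d e v - d e u) := by
  -- Distinct voters may have distance 0; a point at distance 0 from `e` is interchangeable with
  -- `e`.
  have far : ∀ w, d e w = 0 → ∀ z, d w z = d e z := by
    intro w hw z
    have h1 := htri w e z
    have h2 := htri e w z
    rw [hcomm w e] at h1
    omega
  have side : ∀ u v, (d e u = 0 ∨ d e v = 0 ∨ (u ≤ e ∧ v ≤ e) ∨ (e ≤ u ∧ e ≤ v)) →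
      d u v = (d e u - d e v) + (d e v - d e u) := by
    rintro u v (h | h | ⟨h1, h2⟩ | ⟨h1, h2⟩)
    · rw [far u h v, h]; omega
    · rw [hcomm u v, far v h u, h]; omega
    · have c1 := hcomm e u
      have c2 := hcomm e v
      have c3 := hcomm u v
      rcases le_total u v with h | h
      · have := hadd u v e h h2; omega
      · have := hadd v u e h h1; omega
    · have c3 := hcomm u v
      rcases le_total u v with h | h
      · have := hadd e u v h1 h; omega
      · have := hadd e v u h2 h; omega
  -- A point beyond `e` as seen from `o` is at least as far from `o` as `e`, so by additivity and
  -- maximality it is at distance 0 from `e`. Up to such points, everything lies on one side of `e`.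
  have zero : ∀ w, (o ≤ e ∧ e ≤ w) ∨ (e ≤ o ∧ w ≤ e) → d e w = 0 := by
    rintro w (⟨h1, h2⟩ | ⟨h1, h2⟩)
    · have := hadd o e w h1 h2
      have := he w
      omega
    · have := hadd w e o h2 h1
      have := he w
      have := hcomm w o
      have := hcomm e o
      have := hcomm w e
      omega
  apply side
  rcases le_total o e with h | h
  · rcases le_total u e with hu | hu
    · rcases le_total v e with hv | hv
      · exact .inr (.inr (.inl ⟨hu, hv⟩))
      · exact .inr (.inl (zero v (.inl ⟨h, hv⟩)))
    · exact .inl (zero u (.inl ⟨h, hu⟩))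
  · rcases le_total u e with hu | hu
    · exact .inl (zero u (.inr ⟨h, hu⟩))
    · rcases le_total v e with hv | hv
      · exact .inr (.inl (zero v (.inr ⟨h, hv⟩)))
      · exact .inr (.inr (.inr ⟨hu, hv⟩))

/-- The values of `key` are coordinates of the voters on a line that realize their swap distances. -/
def IsCoordinate {m : ℕ} {X : Type} (pref : X → PrefOrder m) (key : X → ℕ) : Prop :=
  ∀ u v, swapDist (pref u) (pref v) = (key u - key v) + (key v - key u)

/-- The order `L` only serves to establish additivity; the coordinates themselves are defined by
swap distances, so an algorithm can compute them without `L`. -/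
theorem SingleCrossing.isCoordinate {m : ℕ} {X : Type} {pref : X → PrefOrder m}
    (h : SingleCrossing pref) {o e : X}
    (he : ∀ x, swapDist (pref o) (pref x) ≤ swapDist (pref o) (pref e)) :
    IsCoordinate pref fun u => swapDist (pref e) (pref u) := by
  obtain ⟨L, hL⟩ := h
  refine dist_eq_of_farthest (d := fun u v => swapDist (pref u) (pref v))
    (fun _ _ => PrefOrder.swapDist_comm _ _)
    (fun _ _ _ => PrefOrder.swapDist_triangle _ _ _) ?_ he
  intro x y z hxy hyz
  refine PrefOrder.swapDist_add fun a b h1 h2 => ?_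
  rcases hxy.eq_or_lt with rfl | hxy
  · exact h1
  · rcases hyz.eq_or_lt with rfl | hyz
    · exact h2
    · exact hL a b x y z hxy hyz h1 h2

namespace IsCoordinate

variable {m : ℕ} {X : Type} {pref : X → PrefOrder m} {key : X → ℕ}

/-- The distance from `u` to `w` splits at `v`, and additivity of the distance gives agreement. Thus
sorting by coordinates recovers the single-crossing property. -/
theorem prefers_of_between (h : IsCoordinate pref key) {u v w : X} (huv : key u ≤ key v)
    (hvw : key v ≤ key w) {a b : Fin m} (h1 : (pref u).Prefers a b) (h2 : (pref w).Prefers a b) :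
    (pref v).Prefers a b := by
  refine PrefOrder.prefers_of_swapDist_add ?_ h1 h2
  rw [h, h, h]; omega

theorem pref_eq (h : IsCoordinate pref key) {u v : X} (huv : key u = key v) : pref u = pref v :=
  PrefOrder.eq_of_swapDist_eq_zero (by rw [h]; omega)

/-- The supporters of `p` form an interval: another top alternative of `v` would be placed below `p`
by both `u` and `w`, hence also by `v`. -/
theorem isTop_of_between (h : IsCoordinate pref key) {u v w : X} (huv : key u ≤ key v)
    (hvw : key v ≤ key w) {p : Fin m} (h1 : (pref u).IsTop p) (h2 : (pref w).IsTop p) :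
    (pref v).IsTop p := by
  obtain ⟨c, hc⟩ := (pref v).exists_isTop p
  by_contra h3
  have hne : c ≠ p := by rintro rfl; exact h3 hc
  exact lt_asymm (hc.prefers hne.symm) (h.prefers_of_between huv hvw (h1.prefers hne) (h2.prefers hne))

end IsCoordinate

/-! ## Condorcet winners on a line -/

section condorcet

variable {m : ℕ} {X : Type} {pref : X → PrefOrder m} {key : X → ℕ}

/-- The voter `u` does not have `p` in the first position, but some voter to its right has. -/
def LeftOf (pref : X → PrefOrder m) (key : X → ℕ) (p : Fin m) (u : X) : Prop :=
  ¬ (pref u).IsTop p ∧ ∃ q, (pref q).IsTop p ∧ key u < key q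

/-- The voter `u` does not have `p` in the first position, but some voter to its left has. -/
def RightOf (pref : X → PrefOrder m) (key : X → ℕ) (p : Fin m) (u : X) : Prop :=
  ¬ (pref u).IsTop p ∧ ∃ q, (pref q).IsTop p ∧ key q < key u

theorem IsCoordinate.leftOf_or_rightOf (h : IsCoordinate pref key) {p : Fin m} {q : X}
    (hq : (pref q).IsTop p) (u : X) :
    LeftOf pref key p u ∨ (pref u).IsTop p ∨ RightOf pref key p u := by
  by_cases hu : (pref u).IsTop p
  · exact .inr (.inl hu)
  rcases lt_trichotomy (key u) (key q) with hk | hk | hk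
  · exact .inl ⟨hu, q, hq, hk⟩
  · rw [h.pref_eq hk] at hu; exact absurd hq hu
  · exact .inr (.inr ⟨hu, q, hq, hk⟩)

theorem IsCoordinate.not_leftOf_rightOf (h : IsCoordinate pref key) {p : Fin m} {u : X}
    (h1 : LeftOf pref key p u) (h2 : RightOf pref key p u) : False := by
  obtain ⟨hu, q, hq, hk⟩ := h1
  obtain ⟨-, r, hr, hk'⟩ := h2
  exact hu (h.isTop_of_between hk'.le hk.le hr hq)

theorem card_prefers_add (S : Finset X) {p c : Fin m} (hc : c ≠ p) :
    (S.filter fun v => (pref v).Prefers p c).card + (S.filter fun v => (pref v).Prefers c p).card =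
      S.card := by
  rw [← Finset.card_filter_add_card_filter_not (s := S) fun v => (pref v).Prefers p c]
  congr 2
  ext v
  simp only [Finset.mem_filter, and_congr_right_iff]
  exact fun _ => ⟨fun h h' => lt_asymm h h', fun h => PrefOrder.prefers_of_not h hc.symm⟩

open Classical in
theorem IsCoordinate.card_add_card_add_card (h : IsCoordinate pref key) (S : Finset X) {p : Fin m}
    {q : X} (hq : (pref q).IsTop p) :
    (S.filter (LeftOf pref key p)).card + (S.filter fun u => (pref u).IsTop p).card +
      (S.filter (RightOf pref key p)).card = S.card := by
  rw [← Finset.card_union_of_disjoint, ← Finset.card_union_of_disjoint]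
  · congr 1
    ext u
    have := h.leftOf_or_rightOf hq u
    simp only [Finset.mem_union, Finset.mem_filter]
    tauto
  · rw [Finset.disjoint_left]
    intro u h1 h2
    simp only [Finset.mem_union, Finset.mem_filter] at h1 h2
    rcases h1 with h1 | h1
    · exact h.not_leftOf_rightOf h1.2 h2.2
    · exact h2.2.1 h1.2
  · rw [Finset.disjoint_left]
    intro u h1 h2
    simp only [Finset.mem_filter] at h1 h2
    exact h1.2.1 h2.2

/-- There is a median voter. -/
theorem exists_median (key : X → ℕ) {S : Finset X} (hS : S.Nonempty) :
    ∃ u ∈ S, 2 * (S.filter fun v => key v < key u).card ≤ S.card ∧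
      2 * (S.filter fun v => key u < key v).card ≤ S.card := by
  obtain ⟨z, hz, hzmax⟩ := S.exists_max_image key hS
  -- The leftmost voter with at most half of the voters strictly to its right; the rightmost voter
  -- shows that there is a candidate.
  obtain ⟨u, hu, hmin⟩ := Finset.exists_min_image
    (S.filter fun u => 2 * (S.filter fun v => key u < key v).card ≤ S.card) key
    ⟨z, Finset.mem_filter.2 ⟨hz, by
      rw [Finset.filter_false_of_mem fun v hv => not_lt.2 (hzmax v hv)]; simp⟩⟩
  rw [Finset.mem_filter] at hu
  refine ⟨u, hu.1, ?_, hu.2⟩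
  rcases (S.filter fun v => key v < key u).eq_empty_or_nonempty with h0 | hne
  · simp [h0]
  · obtain ⟨w, hw, hwmax⟩ := Finset.exists_max_image _ key hne
    rw [Finset.mem_filter] at hw
    -- By minimality of `u`, its nearest neighbour `w` on the left has more than half of the voters
    -- to its right, and all of these are at or beyond `u`.
    have h1 : ¬ 2 * (S.filter fun v => key w < key v).card ≤ S.card := fun h1 =>
      absurd (hmin w (Finset.mem_filter.2 ⟨hw.1, h1⟩)) (not_le.2 hw.2)
    have h2 := Finset.card_filter_add_card_filter_not (s := S) fun v => key v < key u
    have h3 : (S.filter fun v => key w < key v).card ≤ (S.filter fun v => ¬ key v < key u).card := by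
      refine Finset.card_le_card fun v hv => ?_
      rw [Finset.mem_filter] at hv ⊢
      refine ⟨hv.1, fun hlt => ?_⟩
      exact absurd (hwmax v (Finset.mem_filter.2 ⟨hv.1, hlt⟩)) (not_le.2 hv.2)
    omega

/-- A Condorcet winner among at least two alternatives is on top of the median voter. -/
theorem IsCoordinate.exists_isTop_of_condorcet (h : IsCoordinate pref key) {S : Finset X}
    {p : Fin m} (hm : m ≠ 1) (hp : p ∈ condorcetRule S pref) : ∃ u ∈ S, (pref u).IsTop p := by
  have hp : ∀ c, c ≠ p → (S.filter fun v => (pref v).Prefers c p).card <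
    (S.filter fun v => (pref v).Prefers p c).card := hp
  have hex : ∃ c : Fin m, c ≠ p := by
    have := p.2
    by_cases h0 : (p : ℕ) = 0
    · exact ⟨⟨1, by omega⟩, fun e => by simp [← e] at h0⟩
    · exact ⟨⟨0, by omega⟩, fun e => h0 (by simp [← e])⟩
  obtain ⟨c₀, hc₀⟩ := hex
  have hS : S.Nonempty := by
    rw [Finset.nonempty_iff_ne_empty]
    rintro rfl
    simpa using hp c₀ hc₀
  obtain ⟨u, hu, hl, hr⟩ := exists_median key hS
  refine ⟨u, hu, ?_⟩
  obtain ⟨c, hc⟩ := (pref u).exists_isTop p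
  by_contra hup
  have hne : c ≠ p := by rintro rfl; exact hup hc
  have h1 := hp c hne
  have h2 := card_prefers_add (pref := pref) S hne
  have hcp := hc.prefers hne.symm
  -- The median voter prefers `c` to `p`, so the voters preferring `p` to `c` cannot occur on both
  -- sides of it. They are at most half of `S`.
  have hside : (∀ v ∈ S, (pref v).Prefers p c → key v < key u) ∨
      (∀ v ∈ S, (pref v).Prefers p c → key u < key v) := by
    by_contra! hcon
    obtain ⟨⟨v, hv, hvp, hvk⟩, ⟨w, hw, hwp, hwk⟩⟩ := hcon
    exact lt_asymm hcp (h.prefers_of_between hwk hvk hwp hvp)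
  rcases hside with hs | hs
  · have : (S.filter fun v => (pref v).Prefers p c).card ≤
        (S.filter fun v => key v < key u).card :=
      Finset.card_le_card fun v hv => by
        rw [Finset.mem_filter] at hv ⊢; exact ⟨hv.1, hs v hv.1 hv.2⟩
    omega
  · have : (S.filter fun v => (pref v).Prefers p c).card ≤
        (S.filter fun v => key u < key v).card :=
      Finset.card_le_card fun v hv => by
        rw [Finset.mem_filter] at hv ⊢; exact ⟨hv.1, hs v hv.1 hv.2⟩
    omega

open Classical in
/-- A set `Y` of voters on one side of a voter with `p` on top is a minority if `p` is the Condorcet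
winner. -/
theorem IsCoordinate.two_mul_card_lt (h : IsCoordinate pref key) {S Y : Finset X} {p : Fin m}
    (hS : S.Nonempty) (hp : p ∈ condorcetRule S pref) (hY : Y ⊆ S)
    (hside : ∀ z ∈ Y, ¬ (pref z).IsTop p)
    (hend : Y.Nonempty → ∃ u ∈ Y, ∀ v ∈ Y, ∃ q, (pref q).IsTop p ∧
      ((key v ≤ key u ∧ key u ≤ key q) ∨ (key q ≤ key u ∧ key u ≤ key v))) :
    2 * Y.card < S.card := by
  have hp : ∀ c, c ≠ p → (S.filter fun v => (pref v).Prefers c p).card <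
    (S.filter fun v => (pref v).Prefers p c).card := hp
  rcases Y.eq_empty_or_nonempty with rfl | hne
  · simpa using hS.card_pos
  obtain ⟨u, hu, hall⟩ := hend hne
  obtain ⟨c, hc⟩ := (pref u).exists_isTop p
  have hcp : c ≠ p := by rintro rfl; exact hside u hu hc
  have hpc := hc.prefers hcp.symm
  -- The rival `c` is the top of `u`, which separates all of `Y` from supporters of `p`. A member of
  -- `Y` preferring `p` to `c` would force the same on `u`.
  have hsub : Y ⊆ S.filter fun v => (pref v).Prefers c p := by
    intro v hv
    rw [Finset.mem_filter]
    refine ⟨hY hv, ?_⟩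
    by_contra hv'
    have hv' := PrefOrder.prefers_of_not hv' hcp
    obtain ⟨q, hq, ⟨h1, h2⟩ | ⟨h1, h2⟩⟩ := hall v hv
    · exact lt_asymm hpc (h.prefers_of_between h1 h2 hv' (hq.prefers hcp))
    · exact lt_asymm hpc (h.prefers_of_between h1 h2 (hq.prefers hcp) hv')
  have h1 := Finset.card_le_card hsub
  have h2 := hp c hcp
  have h3 := card_prefers_add (pref := pref) S hcp
  omega

-- If p wins, the median voter supports p and each side is a minority. Conversely, a supporter
-- separates the two sides, so the voters preferring a given rival lie on one side only and are a
-- minority. A sole alternative wins even without voters, which the inequalities would not allow.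
open Classical in
theorem IsCoordinate.mem_condorcetRule_iff (h : IsCoordinate pref key) (S : Finset X) (p : Fin m) :
    p ∈ condorcetRule S pref ↔ m = 1 ∨
      ((S.filter (LeftOf pref key p)).card <
        (S.filter fun u => (pref u).IsTop p).card + (S.filter (RightOf pref key p)).card ∧
      (S.filter (RightOf pref key p)).card <
        (S.filter fun u => (pref u).IsTop p).card + (S.filter (LeftOf pref key p)).card) := by
  constructor
  · intro hp
    refine or_iff_not_imp_left.2 fun hm => ?_
    obtain ⟨q, hqS, hq⟩ := h.exists_isTop_of_condorcet hm hp
    have hsum := h.card_add_card_add_card S hq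
    have hL := h.two_mul_card_lt ⟨q, hqS⟩ hp (Finset.filter_subset (LeftOf pref key p) S)
      (fun z hz => (Finset.mem_filter.1 hz).2.1) (fun hne => by
        obtain ⟨u, hu, hmax⟩ := Finset.exists_max_image _ key hne
        obtain ⟨-, r, hr, hk⟩ := (Finset.mem_filter.1 hu).2
        exact ⟨u, hu, fun v hv => ⟨r, hr, .inl ⟨hmax v hv, hk.le⟩⟩⟩)
    have hR := h.two_mul_card_lt ⟨q, hqS⟩ hp (Finset.filter_subset (RightOf pref key p) S)
      (fun z hz => (Finset.mem_filter.1 hz).2.1) (fun hne => by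
        obtain ⟨u, hu, hmin⟩ := Finset.exists_min_image _ key hne
        obtain ⟨-, r, hr, hk⟩ := (Finset.mem_filter.1 hu).2
        exact ⟨u, hu, fun v hv => ⟨r, hr, .inr ⟨hk.le, hmin v hv⟩⟩⟩)
    omega
  · rintro (rfl | ⟨h1, h2⟩)
    · exact fun c hc => absurd (Subsingleton.elim c p) hc
    · intro c hc
      -- Adding the two inequalities cancels both sides.
      have hM : 0 < (S.filter fun u => (pref u).IsTop p).card := by omega
      obtain ⟨q, hq⟩ := Finset.card_pos.1 hM
      replace hq := (Finset.mem_filter.1 hq).2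
      have hsum := h.card_add_card_add_card S hq
      have hcp := card_prefers_add (pref := pref) S hc
      have hside : (∀ v ∈ S, (pref v).Prefers c p → LeftOf pref key p v) ∨
          (∀ v ∈ S, (pref v).Prefers c p → RightOf pref key p v) := by
        by_contra! hcon
        obtain ⟨⟨v, hv, hvp, hvk⟩, ⟨w, hw, hwp, hwk⟩⟩ := hcon
        have hvt : ¬ (pref v).IsTop p := fun ht => lt_asymm hvp (ht.prefers hc)
        have hwt : ¬ (pref w).IsTop p := fun ht => lt_asymm hwp (ht.prefers hc)
        have hqv : key q ≤ key v := not_lt.1 fun hl => hvk ⟨hvt, q, hq, hl⟩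
        have hwq : key w ≤ key q := not_lt.1 fun hl => hwk ⟨hwt, q, hq, hl⟩
        exact lt_asymm (h.prefers_of_between hwq hqv hwp hvp) (hq.prefers hc)
      rcases hside with hs | hs
      · have : (S.filter fun v => (pref v).Prefers c p).card ≤
            (S.filter (LeftOf pref key p)).card :=
          Finset.card_le_card fun v hv => by
            rw [Finset.mem_filter] at hv ⊢; exact ⟨hv.1, hs v hv.1 hv.2⟩
        omega
      · have : (S.filter fun v => (pref v).Prefers c p).card ≤
            (S.filter (RightOf pref key p)).card :=
          Finset.card_le_card fun v hv => by
            rw [Finset.mem_filter] at hv ⊢; exact ⟨hv.1, hs v hv.1 hv.2⟩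
        omega

end condorcet

/-! ## Chains of leaders -/

section chains

open RAM

variable {n : ℕ} {β : Type} [LinearOrder β]

/-- The set `W` has first element `y` and last element `x` in the order given by `f`, and all of its
other elements satisfy `pu`. -/
structure IsChainSet (f : Fin n → β) (pu : Fin n → Prop) (W : Finset (Fin n)) (x y : Fin n) :
    Prop where
  last_mem : x ∈ W
  first_mem : y ∈ W
  le_last : ∀ s ∈ W, f s ≤ f x
  first_le : ∀ s ∈ W, f y ≤ f s
  inner : ∀ s ∈ W, s ≠ y → s ≠ x → pu s

open Classical in
/-- The number of members of the class `C` covered by the bundles of the elements of `W`. -/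
noncomputable def coverage (B : Fin n → Finset (Fin n)) (C : Fin n → Prop) (W : Finset (Fin n)) : ℕ :=
  ((W.biUnion B).filter C).card

open Classical in
/-- The number of members of the class `C` in the bundle of `x` but not in the bundle of `y`. -/
noncomputable def gain (B : Fin n → Finset (Fin n)) (C : Fin n → Prop) (y x : Fin n) : ℕ :=
  ((B x \ B y).filter C).card

/-- The counters fit into single digits of the table. -/
theorem coverage_lt {N : ℕ} (hN : n < N) (B : Fin n → Finset (Fin n)) (C : Fin n → Prop)
    (W : Finset (Fin n)) : coverage B C W < N := by
  classical
  refine lt_of_le_of_lt (Finset.card_le_univ _) ?_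
  simpa using hN

theorem coverage_le {B : Fin n → Finset (Fin n)} {C : Fin n → Prop} {W W' : Finset (Fin n)}
    (h : ∀ s ∈ W, ∀ t ∈ B s, C t → ∃ s' ∈ W', t ∈ B s') : coverage B C W ≤ coverage B C W' := by
  classical
  refine Finset.card_le_card fun t ht => ?_
  simp only [Finset.mem_filter, Finset.mem_biUnion] at ht ⊢
  obtain ⟨⟨s, hs, hts⟩, htC⟩ := ht
  exact ⟨h s hs t hts htC, htC⟩

/-- If a member of the new bundle is covered by any earlier leader, then by `hB` it is also in the
bundle of `w`, which lies between. Comparison with the last leader alone therefore avoids double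
counting. -/
theorem coverage_insert {f : Fin n → β} {B : Fin n → Finset (Fin n)}
    (hB : ∀ x y z, f x ≤ f y → f y ≤ f z → ∀ t ∈ B x, t ∈ B z → t ∈ B y) (C : Fin n → Prop)
    {W : Finset (Fin n)} {w w' : Fin n} (hw : w ∈ W) (hmax : ∀ s ∈ W, f s ≤ f w) (hlt : f w < f w') :
    coverage B C (insert w' W) = coverage B C W + gain B C w w' := by
  classical
  unfold coverage gain
  rw [← Finset.card_union_of_disjoint]
  · congr 1
    ext t
    simp only [Finset.mem_filter, Finset.mem_biUnion, Finset.mem_insert, Finset.mem_union,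
      Finset.mem_sdiff]
    constructor
    · rintro ⟨⟨s, rfl | hs, ht⟩, hC⟩
      · by_cases h : t ∈ B w
        · exact .inl ⟨⟨w, hw, h⟩, hC⟩
        · exact .inr ⟨⟨ht, h⟩, hC⟩
      · exact .inl ⟨⟨s, hs, ht⟩, hC⟩
    · rintro (⟨⟨s, hs, ht⟩, hC⟩ | ⟨⟨ht, -⟩, hC⟩)
      · exact ⟨⟨s, .inr hs, ht⟩, hC⟩
      · exact ⟨⟨w', .inl rfl, ht⟩, hC⟩
  · rw [Finset.disjoint_left]
    intro t h1 h2
    simp only [Finset.mem_filter, Finset.mem_biUnion, Finset.mem_sdiff] at h1 h2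
    obtain ⟨⟨s, hs, ht⟩, -⟩ := h1
    exact h2.1.2 (hB s w w' (hmax s hs) hlt.le t ht h2.1.1)

/-- The states that are reachable by appending leaders one by one describe the chains. -/
theorem reach_chain_iff {N : ℕ} (hN : n < N) {f : Fin n → β} (hf : Function.Injective f)
    {B : Fin n → Finset (Fin n)}
    (hB : ∀ x y z, f x ≤ f y → f y ≤ f z → ∀ t ∈ B x, t ∈ B z → t ∈ B y)
    {Ca Cb Cc pu : Fin n → Prop} {init : ℕ → ℕ → ℕ → ℕ → ℕ → Prop}
    {step : ℕ → ℕ → ℕ → ℕ → ℕ → ℕ → ℕ → ℕ → ℕ → ℕ → Prop}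
    (hinit : ∀ x y a b c, init x y a b c ↔ ∃ w : Fin n, x = w ∧ y = w ∧ a = coverage B Ca {w} ∧
      b = coverage B Cb {w} ∧ c = coverage B Cc {w})
    (hstep : ∀ (w v : Fin n) a b c x' y' a' b' c', step w v a b c x' y' a' b' c' ↔
      ∃ w' : Fin n, x' = w' ∧ f w < f w' ∧ y' = v ∧ (w = v ∨ pu w) ∧ a' = a + gain B Ca w w' ∧
        b' = b + gain B Cb w w' ∧ c' = c + gain B Cc w w')
    (j : ℕ) : ∀ x y a b c : ℕ, Reach N init step j x y a b c ↔
      ∃ (W : Finset (Fin n)) (w v : Fin n), x = w ∧ y = v ∧ W.card = j + 1 ∧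
        IsChainSet f pu W w v ∧ a = coverage B Ca W ∧ b = coverage B Cb W ∧ c = coverage B Cc W := by
  induction j with
  | zero =>
    intro x y a b c
    rw [Reach, hinit]
    constructor
    · rintro ⟨w, rfl, rfl, rfl, rfl, rfl⟩
      refine ⟨{w}, w, w, rfl, rfl, rfl, ⟨by simp, by simp, by simp, by simp, ?_⟩, rfl, rfl, rfl⟩
      intro s hs h
      exact absurd (Finset.mem_singleton.1 hs) h
    · rintro ⟨W, w, v, rfl, rfl, hcard, hch, rfl, rfl, rfl⟩
      obtain ⟨u, rfl⟩ := Finset.card_eq_one.1 hcard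
      have h1 := Finset.mem_singleton.1 hch.last_mem
      have h2 := Finset.mem_singleton.1 hch.first_mem
      subst h1 h2
      exact ⟨_, rfl, rfl, rfl, rfl, rfl⟩
  | succ j ih =>
    intro x' y' a' b' c'
    rw [Reach]
    constructor
    · rintro ⟨x, -, y, -, a, -, b, -, c, -, hr, hs⟩
      obtain ⟨W, w, v, rfl, rfl, hcard, hch, rfl, rfl, rfl⟩ := (ih _ _ _ _ _).1 hr
      obtain ⟨w', rfl, hlt, rfl, hpu, rfl, rfl, rfl⟩ := (hstep _ _ _ _ _ _ _ _ _ _).1 hs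
      have hnm : w' ∉ W := fun h => absurd (hch.le_last _ h) (not_le.2 hlt)
      refine ⟨insert w' W, w', v, rfl, rfl, by rw [Finset.card_insert_of_notMem hnm, hcard],
        ⟨by simp, by simp [hch.first_mem], ?_, ?_, ?_⟩, ?_, ?_, ?_⟩
      · intro s hs
        rcases Finset.mem_insert.1 hs with rfl | hs
        · exact le_rfl
        · exact (hch.le_last s hs).trans hlt.le
      · intro s hs
        rcases Finset.mem_insert.1 hs with rfl | hs
        · exact (hch.le_last v hch.first_mem).trans hlt.le
        · exact hch.first_le s hs
      · intro s hs h1 h2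
        rcases Finset.mem_insert.1 hs with rfl | hs
        · exact absurd rfl h2
        -- `w` stops being last at this step, and exactly now `pu w` is demanded unless `w` is the
        -- first leader.
        · by_cases h3 : s = w
          · subst h3; exact hpu.resolve_left h1
          · exact hch.inner s hs h1 h3
      all_goals rw [coverage_insert hB _ hch.last_mem hch.le_last hlt]
    · rintro ⟨W, w', v, rfl, rfl, hcard, hch, rfl, rfl, rfl⟩
      -- The predecessor state is the chain without its last leader; the greatest remaining leader
      -- becomes its last one.
      have hcard' : (W.erase w').card = j + 1 := by
        rw [Finset.card_erase_of_mem hch.last_mem, hcard]; rfl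
      obtain ⟨w, hw, hmax⟩ := (W.erase w').exists_max_image f (Finset.card_pos.1 (by omega))
      have hwW := Finset.mem_of_mem_erase hw
      have hlt : f w < f w' := lt_of_le_of_ne (hch.le_last w hwW) (hf.ne (Finset.ne_of_mem_erase hw))
      have hvw' : v ≠ w' := by
        rintro rfl
        exact absurd (hch.first_le w hwW) (not_le.2 hlt)
      have hins : insert w' (W.erase w') = W := Finset.insert_erase hch.last_mem
      refine ⟨w, w.2.trans hN, v, v.2.trans hN, _, coverage_lt hN B Ca (W.erase w'), _,
        coverage_lt hN B Cb (W.erase w'), _, coverage_lt hN B Cc (W.erase w'),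
        (ih _ _ _ _ _).2 ⟨W.erase w', w, v, rfl, rfl, hcard',
          ⟨hw, Finset.mem_erase.2 ⟨hvw', hch.first_mem⟩, hmax,
            fun s hs => hch.first_le s (Finset.mem_of_mem_erase hs),
            fun s hs h1 _ => hch.inner s (Finset.mem_of_mem_erase hs) h1 (Finset.ne_of_mem_erase hs)⟩,
          rfl, rfl, rfl⟩,
        (hstep _ _ _ _ _ _ _ _ _ _).2 ⟨w', rfl, hlt, rfl, ?_, ?_, ?_, ?_⟩⟩
      · exact or_iff_not_imp_left.2 fun h => hch.inner w hwW h (Finset.ne_of_mem_erase hw)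
      all_goals rw [← coverage_insert hB _ hw hmax hlt, hins]

theorem exists_isChainSet (f : Fin n → β) {W : Finset (Fin n)} (hW : W.Nonempty) :
    ∃ x y, IsChainSet f (fun _ => True) W x y := by
  obtain ⟨x, hx, hmax⟩ := W.exists_max_image f hW
  obtain ⟨y, hy, hmin⟩ := W.exists_min_image f hW
  exact ⟨x, y, hx, hy, hmax, hmin, fun _ _ _ _ => trivial⟩

/-- For Plurality, in a solution of minimum size all bundles but the first and the last one contain
only supporters of `p`. -/
theorem exists_plurality_chain {m : ℕ} {pref : Fin n → PrefOrder m} {key : Fin n → ℕ}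
    (hkey : ∀ u v w, key u ≤ key v → key v ≤ key w → ∀ p : Fin m, (pref u).IsTop p →
      (pref w).IsTop p → (pref v).IsTop p)
    {f : Fin n → β} (hfk : ∀ u v, f u ≤ f v → key u ≤ key v)
    {B : Fin n → Finset (Fin n)} {d : ℕ}
    (hBd : ∀ x y, y ∈ B x ↔ (key x - key y) + (key y - key x) ≤ d) (V : Fin m → ℕ) (p : Fin m)
    (k : ℕ) :
    (∃ W : Finset (Fin n), W.card ≤ k ∧ ∀ c, c ≠ p → V c + coverage B (fun z => (pref z).IsTop c) W ≤
        V p + coverage B (fun z => (pref z).IsTop p) W) ↔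
      (∀ c, c ≠ p → V c ≤ V p) ∨ ∃ (W : Finset (Fin n)) (x y : Fin n), W.card ≤ k ∧
        IsChainSet f (fun w => ∀ z ∈ B w, (pref z).IsTop p) W x y ∧
        ∀ c, c ≠ p → V c + coverage B (fun z => (pref z).IsTop c) {y, x} ≤
          V p + coverage B (fun z => (pref z).IsTop p) W := by
  classical
  constructor
  · intro hex
    obtain ⟨W, hW, hmin⟩ := Finset.exists_min_image (Finset.univ.filter fun W : Finset (Fin n) =>
      W.card ≤ k ∧ ∀ c, c ≠ p → V c + coverage B (fun z => (pref z).IsTop c) W ≤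
        V p + coverage B (fun z => (pref z).IsTop p) W) Finset.card
      (by obtain ⟨W, hW⟩ := hex; exact ⟨W, by simpa using hW⟩)
    simp only [Finset.mem_filter, Finset.mem_univ, true_and] at hW hmin
    obtain ⟨hWk, hW⟩ := hW
    rcases W.eq_empty_or_nonempty with rfl | hne
    · left; simpa [coverage] using hW
    right
    obtain ⟨x, y, hch⟩ := exists_isChainSet f hne
    -- an element of `W` is useful: no other bundle covers its supporters of `p`
    have useful : ∀ u ∈ W, ∀ s ∈ W, s ≠ u → ∃ t ∈ B u, (pref t).IsTop p ∧ t ∉ B s := by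
      intro u hu s hs hsu
      by_contra! hcon
      -- Dropping `u` would keep the score of `p` and raise no other score, giving a smaller
      -- solution.
      have hsol := hmin (W.erase u) ⟨(Finset.card_erase_le).trans hWk, fun c hc => ?_⟩
      · exact absurd hsol (not_le.2 (Finset.card_erase_lt_of_mem hu))
      have h1 : coverage B (fun z => (pref z).IsTop c) (W.erase u) ≤
          coverage B (fun z => (pref z).IsTop c) W :=
        coverage_le fun s hs t ht _ => ⟨s, Finset.mem_of_mem_erase hs, ht⟩
      have h2 : coverage B (fun z => (pref z).IsTop p) W ≤
          coverage B (fun z => (pref z).IsTop p) (W.erase u) := by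
        refine coverage_le fun r hr t htr htp => ?_
        by_cases hru : r = u
        · subst hru; exact ⟨s, Finset.mem_erase.2 ⟨hsu, hs⟩, hcon t htr htp⟩
        · exact ⟨r, Finset.mem_erase.2 ⟨hru, hr⟩, htr⟩
      have := hW c hc
      omega
    have hpure : ∀ s ∈ W, s ≠ y → s ≠ x → ∀ z ∈ B s, (pref z).IsTop p := by
      intro s hs hsy hsx z hz
      -- The first bundle has a supporter `t` outside the bundle of `s`, hence to its left, and the
      -- last one has a supporter `r` to its right. Everything in the bundle of `s` lies between
      -- them.
      obtain ⟨t, ht, htp, hts⟩ := useful y hch.first_mem s hs hsy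
      obtain ⟨r, hr, hrp, hrs⟩ := useful x hch.last_mem s hs hsx
      have h1 := hfk _ _ (hch.first_le s hs)
      have h2 := hfk _ _ (hch.le_last s hs)
      rw [hBd] at hz ht hts hr hrs
      exact hkey t z r (by omega) (by omega) p htp hrp
    refine ⟨W, x, y, hWk, ⟨hch.last_mem, hch.first_mem, hch.le_last, hch.first_le, hpure⟩, ?_⟩
    intro c hc
    have h1 : coverage B (fun z => (pref z).IsTop c) {y, x} ≤
        coverage B (fun z => (pref z).IsTop c) W := by
      refine coverage_le fun s hs t ht _ => ⟨s, ?_, ht⟩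
      rcases Finset.mem_insert.1 hs with rfl | hs
      · exact hch.first_mem
      · rw [Finset.mem_singleton.1 hs]; exact hch.last_mem
    have := hW c hc
    omega
  · rintro (h | ⟨W, x, y, hWk, hch, h⟩)
    · exact ⟨∅, by simp, by simpa [coverage] using h⟩
    · refine ⟨W, hWk, fun c hc => le_trans ?_ (h c hc)⟩
      -- Inner bundles contain no supporters of `c`, so the two extreme bundles account for all of
      -- them.
      refine Nat.add_le_add_left (coverage_le fun s hs t hts htc => ?_) _
      by_cases hsy : s = y
      · exact ⟨y, by simp, hsy ▸ hts⟩
      by_cases hsx : s = x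
      · exact ⟨x, by simp, hsx ▸ hts⟩
      exact absurd ((hch.inner s hs hsy hsx t hts).eq htc) hc.symm

end chains

/-! ## The algorithms as computable predicates of the input -/

namespace RAM

/-- The values of `t` at numbers with six digits below `N` indicate the relation `R`. -/
def IsTable (N : ℕ) (t : ℕ → ℕ) (R : ℕ → ℕ → ℕ → ℕ → ℕ → ℕ → Prop) : Prop :=
  ∀ j < N, ∀ x < N, ∀ y < N, ∀ a < N, ∀ b < N, ∀ c < N, t (flat N j x y a b c) = ind (R j x y a b c)

theorem eval_mono (T : Polynomial ℕ) {a b : ℕ} (h : a ≤ b) : T.eval a ≤ T.eval b := by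
  rw [Polynomial.eval_eq_sum, Polynomial.eval_eq_sum]
  exact Finset.sum_le_sum fun i _ => Nat.mul_le_mul_left _ (Nat.pow_le_pow_left h i)

theorem length_le_inputLength (l : List ℕ) : l.length ≤ inputLength l := by
  induction l with
  | nil => simp
  | cons a l ih => simp only [inputLength, List.length_cons, List.map_cons, List.sum_cons] at *; omega

/-- Decisions that are computable from two successive tables of layered reachability. -/
theorem exists_program_of_tables {init₁ : ℕ → (ℕ → ℕ) → ℕ → ℕ → ℕ → ℕ → ℕ → Prop}
    {step₁ : ℕ → (ℕ → ℕ) → ℕ → ℕ → ℕ → ℕ → ℕ → ℕ → ℕ → ℕ → ℕ → ℕ → Prop}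
    {init₂ : ℕ → (ℕ → ℕ) → (ℕ → ℕ) → ℕ → ℕ → ℕ → ℕ → ℕ → Prop}
    {step₂ : ℕ → (ℕ → ℕ) → (ℕ → ℕ) → ℕ → ℕ → ℕ → ℕ → ℕ → ℕ → ℕ → ℕ → ℕ → ℕ → Prop}
    {answer : ℕ → (ℕ → ℕ) → (ℕ → ℕ) → (ℕ → ℕ) → Prop}
    (hi₁ : CompP fun μ ρ => init₁ μ.size (μ.arr 0) (ρ 4) (ρ 3) (ρ 2) (ρ 1) (ρ 0))
    (hs₁ : CompP fun μ ρ => step₁ μ.size (μ.arr 0) (ρ 4) (ρ 3) (ρ 2) (ρ 1) (ρ 0)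
      (ρ 9) (ρ 8) (ρ 7) (ρ 6) (ρ 5))
    (hi₂ : CompP fun μ ρ => init₂ μ.size (μ.arr 0) (μ.arr 1) (ρ 4) (ρ 3) (ρ 2) (ρ 1) (ρ 0))
    (hs₂ : CompP fun μ ρ => step₂ μ.size (μ.arr 0) (μ.arr 1) (ρ 4) (ρ 3) (ρ 2) (ρ 1) (ρ 0)
      (ρ 9) (ρ 8) (ρ 7) (ρ 6) (ρ 5))
    (ha : CompP fun μ _ => answer μ.size (μ.arr 0) (μ.arr 1) (μ.arr 2)) :
    ∃ (P : Program) (T : Polynomial ℕ), ∀ l : List ℕ, ∃ t s t₁ t₂,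
      Exec P (initState l) t s ∧ t ≤ T.eval (inputLength l) ∧
      IsTable l.length t₁ (Reach l.length (init₁ l.length fun i => l.getD i 0)
        (step₁ l.length fun i => l.getD i 0)) ∧
      IsTable l.length t₂ (Reach l.length (init₂ l.length (fun i => l.getD i 0) t₁)
        (step₂ l.length (fun i => l.getD i 0) t₁)) ∧
      (s.reg 0 ≠ 0 ↔ answer l.length (fun i => l.getD i 0) t₁ t₂) := by
  obtain ⟨P₁, T₁, h₁⟩ := exists_reach_table 1 (init := fun μ => init₁ μ.size (μ.arr 0))
    (step := fun μ => step₁ μ.size (μ.arr 0)) hi₁ hs₁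
    (fun N A A' h => by simp only [h 0 (by decide)]) (fun N A A' h => by simp only [h 0 (by decide)])
  obtain ⟨P₂, T₂, h₂⟩ := exists_reach_table 2 (init := fun μ => init₂ μ.size (μ.arr 0) (μ.arr 1))
    (step := fun μ => step₂ μ.size (μ.arr 0) (μ.arr 1)) hi₂ hs₂
    (fun N A A' h => by simp only [h 0 (by decide), h 1 (by decide)])
    (fun N A A' h => by simp only [h 0 (by decide), h 1 (by decide)])
  obtain ⟨u, hu⟩ := ha
  -- Register `0` bounds the sums and may be overwritten by the answer only at the very end.
  refine ⟨.seq P₁ (.seq P₂ (.seq (u.compile (fun _ => 0) 1) (.assign 0 (.reg 1)))),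
    T₁ + T₂ + u.bound + 2, fun l => ?_⟩
  obtain ⟨k₁, s₁, e₁, b₁, r₁, a₁, t₁⟩ := h₁ ⟨l.length, (initState l).arr⟩ (initState l)
    (by simp [initState]) (fun _ _ => rfl)
  obtain ⟨k₂, s₂, e₂, b₂, r₂, a₂, t₂⟩ := h₂ ⟨l.length, s₁.arr⟩ s₁ r₁ (fun _ _ => rfl)
  obtain ⟨k₃, s₃, e₃, b₃, a₃, v₃, -⟩ := u.compile_exec (fun _ => 0) 1 s₂ one_pos (fun _ => one_pos)
  have hl : (initState l).arr 0 = fun i => l.getD i 0 := by simp [initState]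
  simp only at r₁ a₁ t₁ r₂ a₂ t₂
  have h10 : s₁.arr 0 = fun i => l.getD i 0 := by rw [a₁ 0 (by decide), hl]
  have h20 : s₂.arr 0 = fun i => l.getD i 0 := by rw [a₂ 0 (by decide), h10]
  have h21 : s₂.arr 1 = s₁.arr 1 := a₂ 1 (by decide)
  rw [h10] at t₂
  rw [hl] at t₁
  refine ⟨_, _, s₁.arr 1, s₂.arr 2, .seq e₁ (.seq e₂ (.seq e₃ (.assign _ _ _))), ?_, t₁, t₂, ?_⟩
  · have hm : ∀ T : Polynomial ℕ, T.eval l.length ≤ T.eval (inputLength l) :=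
      fun T => eval_mono T (length_le_inputLength l)
    have := hm T₁
    have := hm T₂
    have := hm u.bound
    rw [r₂] at b₃
    simp [Expr.cost]
    simp only at b₁ b₂
    omega
  · simp only [State.setReg, Function.update_self, Expr.eval, v₃]
    rw [hu]
    simp only [State.mem, r₂, h20, h21, ind_ne_zero]

/-! ### Reading the input -/

section formulas

variable (N : ℕ) (l o t : ℕ → ℕ)

/-- The alternative in position `i` of voter `u`; the registered voters come first. -/
noncomputable def alt (u i : ℕ) : ℕ :=
  -- Five header entries come first; the sum stands for the product of `u` with the number of
  -- alternatives.
  l (5 + (∑ j ∈ Finset.range N, ind (j < u) * l 0) + i)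

/-- The position of alternative `c` in the order of voter `u`. -/
noncomputable def rank (u c : ℕ) : ℕ :=
  ∑ i ∈ Finset.range N, ind (i < l 0 ∧ alt N l u i = c) * i

/-- The number of pairs of alternatives on which the voters `u` and `v` disagree. -/
noncomputable def disagree (u v : ℕ) : ℕ :=
  ∑ a ∈ Finset.range N, ∑ b ∈ Finset.range N, ind (a < l 0 ∧ b < l 0 ∧
    rank N l u a < rank N l u b ∧ rank N l v b < rank N l v a)

/-- No voter is farther from voter `0` than voter `x`. -/
def IsFarthest (x : ℕ) : Prop :=
  ∀ y < N, y < l 1 + l 2 → disagree N l 0 y ≤ disagree N l 0 x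

/-- The first voter that is farthest from voter `0`. -/
noncomputable def farthest : ℕ :=
  ∑ x ∈ Finset.range N,
    -- Taking the first one makes the index unique, so the sum has at most one nonzero term and
    -- returns that index.
    ind (x < l 1 + l 2 ∧ IsFarthest N l x ∧ ∀ y < N, y < x → ¬ IsFarthest N l y) * x

/-- The coordinate of voter `u` on the line. -/
noncomputable def coord (u : ℕ) : ℕ := disagree N l (farthest N l) u

/-- Voter `u` lies to the left of the supporters of the preferred alternative. -/
def IsLeft (u : ℕ) : Prop :=
  alt N l u 0 ≠ l 3 ∧ ∃ q < N, q < l 1 + l 2 ∧ alt N l q 0 = l 3 ∧ coord N l u < coord N l q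

/-- Voter `u` lies to the right of the supporters of the preferred alternative. -/
def IsRight (u : ℕ) : Prop :=
  alt N l u 0 ≠ l 3 ∧ ∃ q < N, q < l 1 + l 2 ∧ alt N l q 0 = l 3 ∧ coord N l q < coord N l u

/-- The initial state of the enumeration of the indices at which the bundles are listed. -/
def OffsetInit (x y a b c : ℕ) : Prop :=
  x = 5 + (∑ j ∈ Finset.range N, ind (j < l 1 + l 2) * l 0) ∧ y = 0 ∧ a = 0 ∧ b = 0 ∧ c = 0

/-- The steps of the enumeration of the indices at which the bundles are listed. -/
def OffsetStep (_N : ℕ) (l : ℕ → ℕ) (x _y _a _b _c x' y' a' b' c' : ℕ) : Prop :=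
  -- A bundle listed at `x` occupies its length entry plus `l x` members. Only the first digit
  -- carries information.
  x' = x + l x + 1 ∧ y' = 0 ∧ a' = 0 ∧ b' = 0 ∧ c' = 0

/-- The unregistered voter `z` is in the bundle of `w`. -/
def InBundle (w z : ℕ) : Prop :=
  -- Layer `w` of the first table marks the index `c` at which the bundle of `w` is listed.
  ∃ c < N, o (flat N w c 0 0 0 0) ≠ 0 ∧ ∃ i < N, i < l c ∧ l (c + 1 + i) = z

/-- The order of the unregistered voters. -/
def Before (y x : ℕ) : Prop :=
  coord N l (l 1 + y) < coord N l (l 1 + x) ∨ (coord N l (l 1 + y) = coord N l (l 1 + x) ∧ y < x)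

/-- The number of members of the class `C` in the bundle of `x`. -/
noncomputable def firstCount (C : ℕ → Prop) (x : ℕ) : ℕ :=
  ∑ z ∈ Finset.range N, ind (z < l 2 ∧ InBundle N l o x z ∧ C z)

/-- The number of members of the class `C` in the bundle of `x` but not in that of `y`. -/
noncomputable def newCount (C : ℕ → Prop) (y x : ℕ) : ℕ :=
  ∑ z ∈ Finset.range N, ind (z < l 2 ∧ (InBundle N l o x z ∧ ¬ InBundle N l o y z) ∧ C z)

/-- The states of chains with one leader. -/
def ChainInit (Ca Cb Cc : ℕ → Prop) (x y a b c : ℕ) : Prop :=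
  x < l 2 ∧ y = x ∧ a = firstCount N l o Ca x ∧ b = firstCount N l o Cb x ∧ c = firstCount N l o Cc x

/-- Appending a leader to a chain. -/
def ChainStep (Ca Cb Cc pu : ℕ → Prop) (x y a b c x' y' a' b' c' : ℕ) : Prop :=
  x' < l 2 ∧ Before N l x x' ∧ y' = y ∧ (x = y ∨ pu x) ∧ a' = a + newCount N l o Ca x x' ∧
    b' = b + newCount N l o Cb x x' ∧ c' = c + newCount N l o Cc x x'

/-- The number of registered voters in the class `C`. -/
noncomputable def regCount (C : ℕ → Prop) : ℕ := ∑ v ∈ Finset.range N, ind (v < l 1 ∧ C v)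

/-- All voters in the bundle of `w` support the preferred alternative. -/
def IsPure (w : ℕ) : Prop :=
  ∀ z < N, z < l 2 → InBundle N l o w z → alt N l (l 1 + z) 0 = l 3

/-- The decision for Plurality. -/
def PluralityAnswer : Prop :=
  (∀ c < N, c < l 0 → c ≠ l 3 →
    regCount N l (fun v => alt N l v 0 = c) ≤ regCount N l fun v => alt N l v 0 = l 3) ∨
  -- Layer `j` holds chains of `j + 1` leaders, so the bound k on their number reads `j < l 4`. The
  -- outer two counters are idle.
  ∃ j < N, j < l 4 ∧ ∃ x < N, ∃ y < N, ∃ b < N, t (flat N j x y 0 b 0) ≠ 0 ∧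
    ∀ c < N, c < l 0 → c ≠ l 3 → regCount N l (fun v => alt N l v 0 = c) +
      (∑ z ∈ Finset.range N, ind (z < l 2 ∧ (InBundle N l o y z ∨ InBundle N l o x z) ∧
        alt N l (l 1 + z) 0 = c)) ≤ regCount N l (fun v => alt N l v 0 = l 3) + b

/-- Neither the voters on the left nor those on the right are half of all voters. -/
def IsBalanced (L M R : ℕ) : Prop := L < M + R ∧ R < M + L

/-- The decision for Condorcet's rule. -/
def CondorcetAnswer : Prop :=
  l 0 = 1 ∨
  -- The empty set of leaders is not a chain and needs its own case.
  IsBalanced (regCount N l (IsLeft N l)) (regCount N l fun v => alt N l v 0 = l 3)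
    (regCount N l (IsRight N l)) ∨
  ∃ j < N, j < l 4 ∧ ∃ x < N, ∃ y < N, ∃ a < N, ∃ b < N, ∃ c < N, t (flat N j x y a b c) ≠ 0 ∧
    IsBalanced (regCount N l (IsLeft N l) + a) (regCount N l (fun v => alt N l v 0 = l 3) + b)
      (regCount N l (IsRight N l) + c)

end formulas

/-! ### Computability -/

section computability

variable {u v w : Mem → (ℕ → ℕ) → ℕ}

theorem comp_input (k : ℕ) : Comp fun μ _ => μ.arr 0 k := .get 0 (.lit k)

theorem comp_alt (hu : Comp u) (hv : Comp v) :
    Comp fun μ ρ => alt μ.size (μ.arr 0) (u μ ρ) (v μ ρ) := by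
  unfold alt
  exact .get 0 (.add (.add (.lit 5) (.sum (.ind_mul (.lt (.var 0) hu.weaken) (comp_input 0)))) hv)

theorem comp_rank (hu : Comp u) (hv : Comp v) :
    Comp fun μ ρ => rank μ.size (μ.arr 0) (u μ ρ) (v μ ρ) := by
  unfold rank
  exact .sum (.ind_mul (.and (.lt (.var 0) (comp_input 0))
    (.eq (comp_alt hu.weaken (.var 0)) hv.weaken)) (.var 0))

theorem comp_disagree (hu : Comp u) (hv : Comp v) :
    Comp fun μ ρ => disagree μ.size (μ.arr 0) (u μ ρ) (v μ ρ) := by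
  unfold disagree
  exact .sum (.sum (CompP.and (.lt (.var 1) (comp_input 0)) (.and (.lt (.var 0) (comp_input 0))
    (.and (.lt (comp_rank hu.weaken.weaken (.var 1)) (comp_rank hu.weaken.weaken (.var 0)))
      (.lt (comp_rank hv.weaken.weaken (.var 0)) (comp_rank hv.weaken.weaken (.var 1)))))))

theorem comp_isFarthest (hu : Comp u) : CompP fun μ ρ => IsFarthest μ.size (μ.arr 0) (u μ ρ) := by
  unfold IsFarthest
  exact .all (.imp (.lt (.var 0) (.add (comp_input 1) (comp_input 2)))
    (.le (comp_disagree (.lit 0) (.var 0)) (comp_disagree (.lit 0) hu.weaken)))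

theorem comp_farthest : Comp fun μ _ => farthest μ.size (μ.arr 0) := by
  unfold farthest
  exact .sum (.ind_mul (.and (.lt (.var 0) (.add (comp_input 1) (comp_input 2)))
    (.and (comp_isFarthest (.var 0)) (.all (.imp (.lt (.var 0) (.var 1))
      (.not (comp_isFarthest (.var 0))))))) (.var 0))

theorem comp_coord (hu : Comp u) : Comp fun μ ρ => coord μ.size (μ.arr 0) (u μ ρ) :=
  comp_disagree comp_farthest hu

theorem comp_isLeft (hu : Comp u) : CompP fun μ ρ => IsLeft μ.size (μ.arr 0) (u μ ρ) := by
  unfold IsLeft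
  exact .and (.not (.eq (comp_alt hu (.lit 0)) (comp_input 3)))
    (.ex (.and (.lt (.var 0) (.add (comp_input 1) (comp_input 2)))
      (.and (.eq (comp_alt (.var 0) (.lit 0)) (comp_input 3))
        (.lt (comp_coord hu.weaken) (comp_coord (.var 0))))))

theorem comp_isRight (hu : Comp u) : CompP fun μ ρ => IsRight μ.size (μ.arr 0) (u μ ρ) := by
  unfold IsRight
  exact .and (.not (.eq (comp_alt hu (.lit 0)) (comp_input 3)))
    (.ex (.and (.lt (.var 0) (.add (comp_input 1) (comp_input 2)))
      (.and (.eq (comp_alt (.var 0) (.lit 0)) (comp_input 3))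
        (.lt (comp_coord (.var 0)) (comp_coord hu.weaken)))))

theorem comp_offsetInit :
    CompP fun μ ρ => OffsetInit μ.size (μ.arr 0) (ρ 4) (ρ 3) (ρ 2) (ρ 1) (ρ 0) := by
  unfold OffsetInit
  exact .and (.eq (.var 4) (.add (.lit 5) (.sum (.ind_mul (.lt (.var 0)
      (.add (comp_input 1) (comp_input 2))) (comp_input 0)))))
    (.and (.eq (.var 3) (.lit 0)) (.and (.eq (.var 2) (.lit 0))
      (.and (.eq (.var 1) (.lit 0)) (.eq (.var 0) (.lit 0)))))

theorem comp_offsetStep :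
    CompP fun μ ρ => OffsetStep μ.size (μ.arr 0) (ρ 4) (ρ 3) (ρ 2) (ρ 1) (ρ 0)
      (ρ 9) (ρ 8) (ρ 7) (ρ 6) (ρ 5) := by
  unfold OffsetStep
  exact .and (.eq (.var 9) (.add (.add (.var 4) (.get 0 (.var 4))) (.lit 1)))
    (.and (.eq (.var 8) (.lit 0)) (.and (.eq (.var 7) (.lit 0))
      (.and (.eq (.var 6) (.lit 0)) (.eq (.var 5) (.lit 0)))))

theorem comp_inBundle (hu : Comp u) (hv : Comp v) :
    CompP fun μ ρ => InBundle μ.size (μ.arr 0) (μ.arr 1) (u μ ρ) (v μ ρ) := by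
  unfold InBundle
  exact .ex (.and (.not (.eq (.get 1 (.flat hu.weaken (.var 0) (.lit 0) (.lit 0) (.lit 0) (.lit 0)))
    (.lit 0))) (.ex (.and (.lt (.var 0) (.get 0 (.var 1)))
      (.eq (.get 0 (.add (.add (.var 1) (.lit 1)) (.var 0))) hv.weaken.weaken))))

theorem comp_before (hu : Comp u) (hv : Comp v) :
    CompP fun μ ρ => Before μ.size (μ.arr 0) (u μ ρ) (v μ ρ) := by
  unfold Before
  exact .or (.lt (comp_coord (.add (comp_input 1) hu)) (comp_coord (.add (comp_input 1) hv)))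
    (.and (.eq (comp_coord (.add (comp_input 1) hu)) (comp_coord (.add (comp_input 1) hv)))
      (.lt hu hv))

/-- A class of voters that is computable from the input and the first table. -/
def CompClass (C : ℕ → (ℕ → ℕ) → (ℕ → ℕ) → ℕ → Prop) : Prop :=
  ∀ ⦃u : Mem → (ℕ → ℕ) → ℕ⦄, Comp u → CompP fun μ ρ => C μ.size (μ.arr 0) (μ.arr 1) (u μ ρ)

variable {C Ca Cb Cc pu : ℕ → (ℕ → ℕ) → (ℕ → ℕ) → ℕ → Prop}

theorem comp_firstCount (hC : CompClass C) (hu : Comp u) :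
    Comp fun μ ρ => firstCount μ.size (μ.arr 0) (μ.arr 1) (C μ.size (μ.arr 0) (μ.arr 1)) (u μ ρ) := by
  unfold firstCount
  exact .sum (CompP.and (.lt (.var 0) (comp_input 2))
    (.and (comp_inBundle hu.weaken (.var 0)) (hC (.var 0))))

theorem comp_newCount (hC : CompClass C) (hu : Comp u) (hv : Comp v) :
    Comp fun μ ρ =>
      newCount μ.size (μ.arr 0) (μ.arr 1) (C μ.size (μ.arr 0) (μ.arr 1)) (u μ ρ) (v μ ρ) := by
  unfold newCount
  exact .sum (CompP.and (.lt (.var 0) (comp_input 2))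
    (.and (.and (comp_inBundle hv.weaken (.var 0)) (.not (comp_inBundle hu.weaken (.var 0))))
      (hC (.var 0))))

theorem comp_chainInit (ha : CompClass Ca) (hb : CompClass Cb) (hc : CompClass Cc) :
    CompP fun μ ρ => ChainInit μ.size (μ.arr 0) (μ.arr 1) (Ca μ.size (μ.arr 0) (μ.arr 1))
      (Cb μ.size (μ.arr 0) (μ.arr 1)) (Cc μ.size (μ.arr 0) (μ.arr 1))
      (ρ 4) (ρ 3) (ρ 2) (ρ 1) (ρ 0) := by
  unfold ChainInit
  exact .and (.lt (.var 4) (comp_input 2)) (.and (.eq (.var 3) (.var 4))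
    (.and (.eq (.var 2) (comp_firstCount ha (.var 4)))
      (.and (.eq (.var 1) (comp_firstCount hb (.var 4)))
        (.eq (.var 0) (comp_firstCount hc (.var 4))))))

theorem comp_chainStep (ha : CompClass Ca) (hb : CompClass Cb) (hc : CompClass Cc)
    (hp : CompClass pu) :
    CompP fun μ ρ => ChainStep μ.size (μ.arr 0) (μ.arr 1) (Ca μ.size (μ.arr 0) (μ.arr 1))
      (Cb μ.size (μ.arr 0) (μ.arr 1)) (Cc μ.size (μ.arr 0) (μ.arr 1))
      (pu μ.size (μ.arr 0) (μ.arr 1))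
      (ρ 4) (ρ 3) (ρ 2) (ρ 1) (ρ 0) (ρ 9) (ρ 8) (ρ 7) (ρ 6) (ρ 5) := by
  unfold ChainStep
  exact .and (.lt (.var 9) (comp_input 2)) (.and (comp_before (.var 4) (.var 9))
    (.and (.eq (.var 8) (.var 3)) (.and (.or (.eq (.var 4) (.var 3)) (hp (.var 4)))
      (.and (.eq (.var 7) (.add (.var 2) (comp_newCount ha (.var 4) (.var 9))))
        (.and (.eq (.var 6) (.add (.var 1) (comp_newCount hb (.var 4) (.var 9))))
          (.eq (.var 5) (.add (.var 0) (comp_newCount hc (.var 4) (.var 9)))))))))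

theorem comp_regTop (hu : Comp u) :
    Comp fun μ ρ => regCount μ.size (μ.arr 0) fun v => alt μ.size (μ.arr 0) v 0 = u μ ρ := by
  unfold regCount
  exact .sum (CompP.and (.lt (.var 0) (comp_input 1))
    (.eq (comp_alt (.var 0) (.lit 0)) hu.weaken))

theorem comp_regLeft : Comp fun μ _ => regCount μ.size (μ.arr 0) (IsLeft μ.size (μ.arr 0)) := by
  unfold regCount
  exact .sum (CompP.and (.lt (.var 0) (comp_input 1)) (comp_isLeft (.var 0)))

theorem comp_regRight : Comp fun μ _ => regCount μ.size (μ.arr 0) (IsRight μ.size (μ.arr 0)) := by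
  unfold regCount
  exact .sum (CompP.and (.lt (.var 0) (comp_input 1)) (comp_isRight (.var 0)))

theorem comp_balanced (hu : Comp u) (hv : Comp v) (hw : Comp w) :
    CompP fun μ ρ => IsBalanced (u μ ρ) (v μ ρ) (w μ ρ) := by
  unfold IsBalanced
  exact .and (.lt hu (.add hv hw)) (.lt hw (.add hv hu))

theorem compClass_isPure : CompClass IsPure := by
  intro u hu
  unfold IsPure
  exact .all (.imp (.lt (.var 0) (comp_input 2)) (.imp (comp_inBundle hu.weaken (.var 0))
    (.eq (comp_alt (.add (comp_input 1) (.var 0)) (.lit 0)) (comp_input 3))))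

theorem compClass_supporter : CompClass fun N l _ z => alt N l (l 1 + z) 0 = l 3 :=
  fun _ hu => .eq (comp_alt (.add (comp_input 1) hu) (.lit 0)) (comp_input 3)

theorem compClass_left : CompClass fun N l _ z => IsLeft N l (l 1 + z) :=
  fun _ hu => comp_isLeft (.add (comp_input 1) hu)

theorem compClass_right : CompClass fun N l _ z => IsRight N l (l 1 + z) :=
  fun _ hu => comp_isRight (.add (comp_input 1) hu)

theorem compClass_false : CompClass fun _ _ _ _ => False :=
  fun _ _ => (CompP.lt (.lit 0) (.lit 0)).congr fun _ _ => by simp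

theorem compClass_true : CompClass fun _ _ _ _ => True :=
  fun _ _ => (CompP.lt (.lit 0) (.lit 1)).congr fun _ _ => by simp

theorem comp_pluralityAnswer :
    CompP fun μ _ => PluralityAnswer μ.size (μ.arr 0) (μ.arr 1) (μ.arr 2) := by
  unfold PluralityAnswer
  refine .or (.all (.imp (.lt (.var 0) (comp_input 0)) (.imp (.not (.eq (.var 0) (comp_input 3)))
    (.le (comp_regTop (.var 0)) (comp_regTop (comp_input 3)))))) ?_
  refine .ex (.and (.lt (.var 0) (comp_input 4)) (.ex (.ex (.ex (.and (.not (.eq (.get 2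
    (.flat (.var 3) (.var 2) (.var 1) (.lit 0) (.var 0) (.lit 0))) (.lit 0))) ?_)))))
  refine .all (.imp (.lt (.var 0) (comp_input 0)) (.imp (.not (.eq (.var 0) (comp_input 3)))
    (.le (.add (comp_regTop (.var 0)) (.sum ?_)) (.add (comp_regTop (comp_input 3)) (.var 1)))))
  exact CompP.and (.lt (.var 0) (comp_input 2))
    (.and (.or (comp_inBundle (.var 3) (.var 0)) (comp_inBundle (.var 4) (.var 0)))
      (.eq (comp_alt (.add (comp_input 1) (.var 0)) (.lit 0)) (.var 1)))

theorem comp_condorcetAnswer :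
    CompP fun μ _ => CondorcetAnswer μ.size (μ.arr 0) (μ.arr 2) := by
  unfold CondorcetAnswer
  refine .or (.eq (comp_input 0) (.lit 1)) (.or
    (comp_balanced comp_regLeft (comp_regTop (comp_input 3)) comp_regRight) ?_)
  exact .ex (.and (.lt (.var 0) (comp_input 4)) (.ex (.ex (.ex (.ex (.ex (.and (.not (.eq (.get 2
    (.flat (.var 5) (.var 4) (.var 3) (.var 2) (.var 1) (.var 0))) (.lit 0)))
    (comp_balanced (.add comp_regLeft (.var 2)) (.add (comp_regTop (comp_input 3)) (.var 1))
      (.add comp_regRight (.var 0))))))))))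

/-- Decisions that are computable from the table of the chains of leaders. -/
theorem exists_program_of_classes (ha : CompClass Ca) (hb : CompClass Cb) (hc : CompClass Cc)
    (hp : CompClass pu) {answer : ℕ → (ℕ → ℕ) → (ℕ → ℕ) → (ℕ → ℕ) → Prop}
    (hans : CompP fun μ _ => answer μ.size (μ.arr 0) (μ.arr 1) (μ.arr 2)) :
    ∃ (P : Program) (T : Polynomial ℕ), ∀ L : List ℕ, ∃ t s o tab,
      Exec P (initState L) t s ∧ t ≤ T.eval (inputLength L) ∧
      (let N := L.length
       let l := fun i => L.getD i 0
       IsTable N o (Reach N (OffsetInit N l) (OffsetStep N l)) ∧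
       IsTable N tab (Reach N (ChainInit N l o (Ca N l o) (Cb N l o) (Cc N l o))
         (ChainStep N l o (Ca N l o) (Cb N l o) (Cc N l o) (pu N l o))) ∧
       (s.reg 0 ≠ 0 ↔ answer N l o tab)) :=
  exists_program_of_tables
    (init₂ := fun N l o => ChainInit N l o (Ca N l o) (Cb N l o) (Cc N l o))
    (step₂ := fun N l o => ChainStep N l o (Ca N l o) (Cb N l o) (Cc N l o) (pu N l o))
    comp_offsetInit comp_offsetStep (comp_chainInit ha hb hc) (comp_chainStep ha hb hc hp) hans

end computability

end RAM

/-! ## Decoding the input -/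

section sums

open RAM

theorem sum_range_eq_sum_fin {n N : ℕ} (h : n ≤ N) {g : ℕ → ℕ} (hg : ∀ a, n ≤ a → g a = 0) :
    ∑ a ∈ Finset.range N, g a = ∑ a : Fin n, g a := by
  rw [← Finset.sum_range]
  symm
  refine Finset.sum_subset (fun a ha => ?_) fun a _ ha => hg a ?_
  · simp only [Finset.mem_range] at *; omega
  · simpa using ha

open Classical in
theorem sum_ind_eq_card {n N : ℕ} (h : n ≤ N) (P : ℕ → Prop) :
    ∑ z ∈ Finset.range N, ind (z < n ∧ P z) =
      (Finset.univ.filter fun z : Fin n => P z).card := by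
  rw [sum_range_eq_sum_fin h fun a ha => ind_of_not fun h' => absurd h'.1 (not_lt.2 ha),
    Finset.card_filter]
  refine Finset.sum_congr rfl fun z _ => ?_
  simp [ind]

theorem sum_ind_lt_mul {u N : ℕ} (h : u ≤ N) (c : ℕ) :
    ∑ j ∈ Finset.range N, ind (j < u) * c = u * c := by
  rw [sum_range_eq_sum_fin h fun a ha => by rw [ind_of_not (not_lt.2 ha), zero_mul]]
  simp [ind]

/-- Bounded sums act as a definite description operator; positions and the farthest voter are read
off in this way. -/
theorem sum_ind_mul_eq {x N : ℕ} (hx : x < N) {P : ℕ → Prop} (hP : ∀ i < N, P i ↔ i = x) :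
    ∑ i ∈ Finset.range N, ind (P i) * i = x := by
  rw [Finset.sum_eq_single x]
  · rw [ind_of ((hP x hx).2 rfl), one_mul]
  · intro i hi hne
    rw [ind_of_not fun h => hne ((hP i (Finset.mem_range.1 hi)).1 h), zero_mul]
  · intro h; exact absurd (Finset.mem_range.2 hx) h

end sums

/-- The total length of the first `v` blocks. -/
def blockStart {n : ℕ} (f : Fin n → List ℕ) (v : ℕ) : ℕ :=
  (((List.finRange n).take v).flatMap f).length

theorem blockStart_zero {n : ℕ} (f : Fin n → List ℕ) : blockStart f 0 = 0 := by simp [blockStart]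

theorem blockStart_succ {n : ℕ} (f : Fin n → List ℕ) (v : Fin n) :
    blockStart f (v + 1) = blockStart f v + (f v).length := by
  unfold blockStart
  rw [List.take_succ_eq_append_getElem (by simp)]
  simp

theorem blockStart_self {n : ℕ} (f : Fin n → List ℕ) :
    blockStart f n = ((List.finRange n).flatMap f).length := by
  unfold blockStart
  rw [List.take_of_length_le (by simp)]

theorem blockStart_mono {n : ℕ} (f : Fin n → List ℕ) {v w : ℕ} (h : v ≤ w) :
    blockStart f v ≤ blockStart f w := by
  unfold blockStart
  obtain ⟨k, rfl⟩ := Nat.exists_eq_add_of_le h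
  rw [List.take_add, List.flatMap_append, List.length_append]
  exact Nat.le_add_right _ _

theorem blockStart_const {n m : ℕ} {f : Fin n → List ℕ} (hf : ∀ v, (f v).length = m) :
    ∀ v ≤ n, blockStart f v = v * m := by
  intro v
  induction v with
  | zero => intro _; simp [blockStart_zero]
  | succ v ih =>
    intro hv
    rw [blockStart_succ f ⟨v, hv⟩, hf, ih (by omega)]
    ring

theorem getD_flatMap {n : ℕ} (f : Fin n → List ℕ) (v : Fin n) {i : ℕ} (hi : i < (f v).length) :
    ((List.finRange n).flatMap f).getD (blockStart f v + i) 0 = (f v).getD i 0 := by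
  have hsplit : (List.finRange n).flatMap f = ((List.finRange n).take v).flatMap f ++
      (f v ++ ((List.finRange n).drop (v + 1)).flatMap f) := by
    conv_lhs => rw [← List.take_append_drop v (List.finRange n),
      List.drop_eq_getElem_cons (by simp)]
    simp
  rw [hsplit, List.getD_append_right _ _ _ _ (by unfold blockStart; omega)]
  rw [List.getD_append _ _ _ _ (by unfold blockStart; omega)]
  congr 1
  unfold blockStart
  omega

/-! ### The layout of an encoded instance -/

namespace CCCAV

open RAM

variable (I : CCCAV)

/-- The entries of the input. -/
def entry (i : ℕ) : ℕ := I.encode.getD i 0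

/-- The number of entries of the input. -/
def size : ℕ := I.encode.length

/-- The number of a voter; the registered voters come first. -/
def voterIndex : Fin I.nV ⊕ Fin I.nW → ℕ :=
  Sum.elim (fun v => (v : ℕ)) fun w => I.nV + w

/-- The index at which the bundle of the unregistered voter `w` is listed. -/
def bundleStart (w : ℕ) : ℕ :=
  5 + (I.nV + I.nW) * I.m + blockStart (fun w => encodeBundle (I.bundle w)) w

@[simp] theorem entry_zero : I.entry 0 = I.m := rfl
@[simp] theorem entry_one : I.entry 1 = I.nV := rfl
@[simp] theorem entry_two : I.entry 2 = I.nW := rfl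
@[simp] theorem entry_three : I.entry 3 = I.p := rfl
@[simp] theorem entry_four : I.entry 4 = I.k := rfl

theorem length_encodePref {m : ℕ} (π : PrefOrder m) : (encodePref π).length = m := by
  simp [encodePref]

theorem getD_encodePref {m : ℕ} (π : PrefOrder m) (i : Fin m) : (encodePref π).getD i 0 = π i := by
  simp [encodePref, List.getD_eq_getElem?_getD]

theorem length_encodeBundle {n : ℕ} (B : Finset (Fin n)) : (encodeBundle B).length = B.card + 1 := by
  simp [encodeBundle]

theorem length_flatMap_pref {n m : ℕ} (f : Fin n → PrefOrder m) :
    ((List.finRange n).flatMap fun v => encodePref (f v)).length = n * m := by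
  rw [← blockStart_self, blockStart_const (fun v => length_encodePref _) n le_rfl]

theorem size_eq : I.size = I.bundleStart I.nW := by
  unfold size encode bundleStart
  rw [blockStart_self]
  simp only [List.length_append, length_flatMap_pref]
  simp only [List.length_cons, List.length_nil]
  ring

theorem bundleStart_succ (w : Fin I.nW) :
    I.bundleStart (w + 1) = I.bundleStart w + (I.bundle w).card + 1 := by
  unfold bundleStart
  rw [blockStart_succ, length_encodeBundle]
  ring

theorem bundleStart_add_le (w : Fin I.nW) :
    I.bundleStart w + (I.bundle w).card + 1 ≤ I.size := by
  rw [← bundleStart_succ, size_eq]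
  exact Nat.add_le_add_left (blockStart_mono _ w.2) _

theorem le_bundleStart : ∀ w ≤ I.nW, 5 + (I.nV + I.nW) * I.m + w ≤ I.bundleStart w := by
  intro w
  induction w with
  | zero => intro _; simp [bundleStart, blockStart_zero]
  | succ w ih =>
    intro hw
    have := ih (by omega)
    rw [bundleStart_succ I ⟨w, hw⟩]
    simp only
    omega

theorem le_size : 5 + (I.nV + I.nW) * I.m + I.nW ≤ I.size :=
  I.size_eq ▸ I.le_bundleStart _ le_rfl

/-- Every preference order occupies at least one entry, because `p` is an alternative. So voters,
and counts of unregistered voters, are valid digits. -/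
theorem voters_lt_size : I.nV + I.nW < I.size := by
  have h := I.le_size
  have : I.nV + I.nW ≤ (I.nV + I.nW) * I.m := Nat.le_mul_of_pos_right _ I.p.pos
  omega

/-- One listed order suffices. Without voters no order is listed, and the number of alternatives may
exceed the number of entries. -/
theorem m_le_size (h : 0 < I.nV + I.nW) : I.m ≤ I.size := by
  have h' := I.le_size
  have : I.m ≤ (I.nV + I.nW) * I.m := Nat.le_mul_of_pos_left _ h
  omega

theorem voterIndex_lt (u : Fin I.nV ⊕ Fin I.nW) : I.voterIndex u < I.nV + I.nW := by
  rcases u with v | w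
  · simp only [voterIndex, Sum.elim_inl]; omega
  · simp only [voterIndex, Sum.elim_inr]; omega

theorem exists_voterIndex {x : ℕ} (hx : x < I.nV + I.nW) : ∃ u, I.voterIndex u = x := by
  by_cases h : x < I.nV
  · exact ⟨.inl ⟨x, h⟩, rfl⟩
  · refine ⟨.inr ⟨x - I.nV, by omega⟩, ?_⟩
    simp only [voterIndex, Sum.elim_inr]; omega

theorem m_le_size_of_voter (u : Fin I.nV ⊕ Fin I.nW) : I.m ≤ I.size :=
  I.m_le_size (lt_of_le_of_lt (Nat.zero_le _) (I.voterIndex_lt u))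

theorem entry_pref (u : Fin I.nV ⊕ Fin I.nW) (i : Fin I.m) :
    I.entry (5 + I.voterIndex u * I.m + i) = I.pref u i := by
  have hreg := length_flatMap_pref I.regPref
  have hunreg := length_flatMap_pref I.unregPref
  have hi := i.2
  unfold entry encode
  rcases u with v | w
  · have hv : (v : ℕ) * I.m + i < I.nV * I.m := by
      have : ((v : ℕ) + 1) * I.m ≤ I.nV * I.m := Nat.mul_le_mul_right _ v.2
      rw [add_mul] at this; omega
    simp only [voterIndex, Sum.elim_inl, pref]
    rw [List.getD_append _ _ _ _ (by simp only [List.length_append, hreg, hunreg, List.length_cons, List.length_nil]; omega),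
      List.getD_append _ _ _ _ (by simp only [List.length_append, hreg, List.length_cons, List.length_nil]; omega),
      List.getD_append_right _ _ _ _ (by simp only [List.length_cons, List.length_nil]; omega)]
    have := getD_flatMap (fun v => encodePref (I.regPref v)) v (i := i) (by rw [length_encodePref]; exact hi)
    rw [blockStart_const (fun v => length_encodePref _) v v.2.le, getD_encodePref] at this
    rw [← this]
    congr 1
    simp only [List.length_cons, List.length_nil]; omega
  · have hw : (w : ℕ) * I.m + i < I.nW * I.m := by
      have : ((w : ℕ) + 1) * I.m ≤ I.nW * I.m := Nat.mul_le_mul_right _ w.2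
      rw [add_mul] at this; omega
    simp only [voterIndex, Sum.elim_inr, pref, add_mul]
    rw [List.getD_append _ _ _ _ (by simp only [List.length_append, hreg, hunreg, List.length_cons, List.length_nil]; omega),
      List.getD_append_right _ _ _ _ (by simp only [List.length_append, hreg, List.length_cons, List.length_nil]; omega)]
    have := getD_flatMap (fun v => encodePref (I.unregPref v)) w (i := i) (by rw [length_encodePref]; exact hi)
    rw [blockStart_const (fun v => length_encodePref _) w w.2.le, getD_encodePref] at this
    rw [← this]
    congr 1
    simp only [List.length_append, hreg, List.length_cons, List.length_nil]; omega

theorem entry_bundle (w : Fin I.nW) {i : ℕ} (hi : i < (I.bundle w).card + 1) :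
    I.entry (I.bundleStart w + i) = (encodeBundle (I.bundle w)).getD i 0 := by
  have hreg := length_flatMap_pref I.regPref
  have hunreg := length_flatMap_pref I.unregPref
  rw [← getD_flatMap (fun w => encodeBundle (I.bundle w)) w (by rw [length_encodeBundle]; exact hi)]
  unfold entry encode bundleStart
  rw [List.getD_append_right _ _ _ _ (by
    simp only [List.length_append, hreg, hunreg, List.length_cons, List.length_nil, add_mul]; omega)]
  congr 1
  simp only [List.length_append, hreg, hunreg, List.length_cons, List.length_nil, add_mul]; omega

theorem entry_bundleStart (w : Fin I.nW) : I.entry (I.bundleStart w) = (I.bundle w).card := by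
  simpa [encodeBundle] using I.entry_bundle w (i := 0) (by omega)

theorem mem_bundle_iff (w z : Fin I.nW) :
    z ∈ I.bundle w ↔ ∃ i < (I.bundle w).card, I.entry (I.bundleStart w + 1 + i) = z := by
  have key : ∀ i (hi : i < (I.bundle w).card), I.entry (I.bundleStart w + 1 + i) =
      (((I.bundle w).sort (· ≤ ·))[i]'(by simpa using hi) : ℕ) := by
    intro i hi
    rw [add_assoc, add_comm 1, I.entry_bundle w (by omega)]
    simp [encodeBundle, hi, ← List.map_eq_flatMap]
  rw [← Finset.mem_sort (· ≤ ·), List.mem_iff_getElem]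
  constructor
  · rintro ⟨i, hi, h⟩
    rw [Finset.length_sort] at hi
    exact ⟨i, hi, by rw [key i hi, h]⟩
  · rintro ⟨i, hi, h⟩
    rw [key i hi] at h
    exact ⟨i, by simpa using hi, Fin.ext h⟩

/-! ### The formulas on an input -/

theorem alt_voterIndex (u : Fin I.nV ⊕ Fin I.nW) (i : Fin I.m) :
    alt I.size I.entry (I.voterIndex u) i = I.pref u i := by
  unfold alt
  rw [sum_ind_lt_mul ((I.voterIndex_lt u).trans I.voters_lt_size).le, entry_zero, entry_pref]

theorem alt_eq_iff (u : Fin I.nV ⊕ Fin I.nW) (c : Fin I.m) :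
    alt I.size I.entry (I.voterIndex u) 0 = c ↔ (I.pref u).IsTop c := by
  have := I.alt_voterIndex u ⟨0, c.pos⟩
  simp only at this
  rw [this, PrefOrder.IsTop, ← Fin.ext_iff, eq_comm, ← Equiv.symm_apply_eq, Fin.ext_iff]

theorem rank_voterIndex (u : Fin I.nV ⊕ Fin I.nW) (c : Fin I.m) :
    rank I.size I.entry (I.voterIndex u) c = (I.pref u).symm c := by
  unfold rank
  refine sum_ind_mul_eq (((I.pref u).symm c).2.trans_le (I.m_le_size_of_voter u)) fun i _ => ?_
  rw [entry_zero]
  constructor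
  · rintro ⟨hi, h⟩
    have := I.alt_voterIndex u ⟨i, hi⟩
    simp only at this
    rw [this, ← Fin.ext_iff, ← Equiv.eq_symm_apply] at h
    exact congrArg Fin.val h
  · rintro rfl
    exact ⟨Fin.is_lt _, by rw [alt_voterIndex, Equiv.apply_symm_apply]⟩

/-- The double sum counts inversions. -/
theorem disagree_voterIndex (u v : Fin I.nV ⊕ Fin I.nW) :
    disagree I.size I.entry (I.voterIndex u) (I.voterIndex v) =
      swapDist (I.pref u) (I.pref v) := by
  have hm := I.m_le_size_of_voter u
  unfold disagree
  rw [sum_range_eq_sum_fin hm fun a ha => Finset.sum_eq_zero fun b _ =>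
    ind_of_not fun h => absurd h.1 (not_lt.2 (by simpa using ha))]
  have h1 : ∀ a : Fin I.m, (∑ b ∈ Finset.range I.size, ind ((a : ℕ) < I.entry 0 ∧ b < I.entry 0 ∧
      rank I.size I.entry (I.voterIndex u) a < rank I.size I.entry (I.voterIndex u) b ∧
      rank I.size I.entry (I.voterIndex v) b < rank I.size I.entry (I.voterIndex v) a)) =
      ∑ b : Fin I.m, if (I.pref u).Prefers a b ∧ (I.pref v).Prefers b a then 1 else 0 := by
    intro a
    rw [sum_range_eq_sum_fin hm fun b hb =>
      ind_of_not fun h => absurd h.2.1 (not_lt.2 (by simpa using hb))]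
    refine Finset.sum_congr rfl fun b _ => ?_
    simp only [rank_voterIndex, entry_zero, Fin.is_lt, true_and, ind, Fin.val_fin_lt]
  rw [Finset.sum_congr rfl fun a _ => h1 a, ← Finset.sum_product',
    swapDist_eq_card_inversions, PrefOrder.inversions, Finset.card_filter]
  rfl

theorem exists_farthest (h : 0 < I.nV + I.nW) : ∃ o e, farthest I.size I.entry = I.voterIndex e ∧
    ∀ x, swapDist (I.pref o) (I.pref x) ≤ swapDist (I.pref o) (I.pref e) := by
  classical
  obtain ⟨o, ho⟩ := I.exists_voterIndex h
  have hiff : ∀ e, IsFarthest I.size I.entry (I.voterIndex e) ↔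
      ∀ x, swapDist (I.pref o) (I.pref x) ≤ swapDist (I.pref o) (I.pref e) := by
    intro e
    unfold IsFarthest
    rw [← ho]
    constructor
    · intro h x
      rw [← disagree_voterIndex, ← disagree_voterIndex]
      exact h _ ((I.voterIndex_lt x).trans I.voters_lt_size) (I.voterIndex_lt x)
    · intro h y _ hy
      obtain ⟨x, rfl⟩ := I.exists_voterIndex hy
      rw [disagree_voterIndex, disagree_voterIndex]
      exact h x
  have hex : ∃ x, x < I.nV + I.nW ∧ IsFarthest I.size I.entry x := by
    obtain ⟨e, -, he⟩ := Finset.exists_max_image Finset.univ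
      (fun x => swapDist (I.pref o) (I.pref x)) ⟨o, Finset.mem_univ _⟩
    exact ⟨_, I.voterIndex_lt e, (hiff e).2 fun x => he x (Finset.mem_univ _)⟩
  obtain ⟨hlt, hfar⟩ := Nat.find_spec hex
  obtain ⟨e, he⟩ := I.exists_voterIndex hlt
  refine ⟨o, e, ?_, (hiff e).1 (he ▸ hfar)⟩
  unfold farthest
  rw [he]
  refine sum_ind_mul_eq (hlt.trans I.voters_lt_size) fun i _ => ?_
  rw [entry_one, entry_two]
  constructor
  · rintro ⟨h1, h2, h3⟩
    refine le_antisymm (not_lt.1 fun h4 => ?_) (Nat.find_min' hex ⟨h1, h2⟩)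
    exact h3 _ (hlt.trans I.voters_lt_size) h4 hfar
  · rintro rfl
    exact ⟨hlt, hfar, fun y _ hy hy' => Nat.find_min hex hy ⟨hy.trans hlt, hy'⟩⟩

theorem exists_key (h : SingleCrossing I.pref) : ∃ key, IsCoordinate I.pref key ∧
    ∀ u, coord I.size I.entry (I.voterIndex u) = key u := by
  rcases Nat.eq_zero_or_pos (I.nV + I.nW) with h0 | h0
  · have : ∀ u, ¬ I.voterIndex u < 0 := fun u => Nat.not_lt_zero _
    refine ⟨fun _ => 0, fun u => ?_, fun u => ?_⟩ <;>
      exact absurd (h0 ▸ I.voterIndex_lt u) (this u)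
  · obtain ⟨o, e, hfar, he⟩ := I.exists_farthest h0
    exact ⟨_, h.isCoordinate he, fun u => by rw [coord, hfar, disagree_voterIndex]⟩

section key

variable {I} {key : Fin I.nV ⊕ Fin I.nW → ℕ}

theorem isLeft_iff (hkey : ∀ u, coord I.size I.entry (I.voterIndex u) = key u)
    (u : Fin I.nV ⊕ Fin I.nW) :
    IsLeft I.size I.entry (I.voterIndex u) ↔ LeftOf I.pref key I.p u := by
  unfold IsLeft LeftOf
  rw [entry_three, ne_eq, alt_eq_iff, hkey]
  refine and_congr_right fun _ => ⟨?_, ?_⟩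
  · rintro ⟨q, -, hq, h1, h2⟩
    obtain ⟨q, rfl⟩ := I.exists_voterIndex hq
    exact ⟨q, (I.alt_eq_iff q _).1 h1, by rwa [hkey q] at h2⟩
  · rintro ⟨q, h1, h2⟩
    exact ⟨_, (I.voterIndex_lt q).trans I.voters_lt_size, I.voterIndex_lt q,
      (I.alt_eq_iff q _).2 h1, by rwa [hkey]⟩

theorem isRight_iff (hkey : ∀ u, coord I.size I.entry (I.voterIndex u) = key u)
    (u : Fin I.nV ⊕ Fin I.nW) :
    IsRight I.size I.entry (I.voterIndex u) ↔ RightOf I.pref key I.p u := by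
  unfold IsRight RightOf
  rw [entry_three, ne_eq, alt_eq_iff, hkey]
  refine and_congr_right fun _ => ⟨?_, ?_⟩
  · rintro ⟨q, -, hq, h1, h2⟩
    obtain ⟨q, rfl⟩ := I.exists_voterIndex hq
    exact ⟨q, (I.alt_eq_iff q _).1 h1, by rwa [hkey q] at h2⟩
  · rintro ⟨q, h1, h2⟩
    exact ⟨_, (I.voterIndex_lt q).trans I.voters_lt_size, I.voterIndex_lt q,
      (I.alt_eq_iff q _).2 h1, by rwa [hkey]⟩

end key

end CCCAV

namespace CCCAV

open RAM

variable {I : CCCAV}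

/-! ### Bundles and chains of leaders -/

theorem bundleStart_lt (w : Fin I.nW) : I.bundleStart w < I.size := by
  have := I.bundleStart_add_le w; omega

/-- Each layer contains a single state, because a step is determined by the length entry at the
current index. -/
theorem reach_offset_iff (w : ℕ) : w < I.nW → ∀ x y a b c,
    Reach I.size (OffsetInit I.size I.entry) (OffsetStep I.size I.entry) w x y a b c ↔
      x = I.bundleStart w ∧ y = 0 ∧ a = 0 ∧ b = 0 ∧ c = 0 := by
  induction w with
  | zero =>
    intro _ x y a b c
    rw [Reach, OffsetInit, entry_zero, entry_one, entry_two, sum_ind_lt_mul I.voters_lt_size.le,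
      bundleStart, blockStart_zero, add_zero]
  | succ w ih =>
    intro hw x y a b c
    have hw' : w < I.nW := by omega
    have hs : I.bundleStart (w + 1) = I.bundleStart w + I.entry (I.bundleStart w) + 1 := by
      rw [I.bundleStart_succ ⟨w, hw'⟩, I.entry_bundleStart ⟨w, hw'⟩]
    rw [Reach, hs]
    constructor
    · rintro ⟨x', -, y', -, a', -, b', -, c', -, hr, hst⟩
      obtain ⟨rfl, -⟩ := (ih hw' _ _ _ _ _).1 hr
      exact hst
    · intro h
      have h0 : 0 < I.size := lt_of_le_of_lt (Nat.zero_le _) I.voters_lt_size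
      exact ⟨_, bundleStart_lt ⟨w, hw'⟩, 0, h0, 0, h0, 0, h0, 0, h0,
        (ih hw' _ _ _ _ _).2 ⟨rfl, rfl, rfl, rfl, rfl⟩, h⟩

/-- The first table enumerates the indices at which the bundles are listed. -/
def IsOffsetTable (I : CCCAV) (o : ℕ → ℕ) : Prop :=
  IsTable I.size o (Reach I.size (OffsetInit I.size I.entry) (OffsetStep I.size I.entry))

theorem unreg_lt_size (w : Fin I.nW) : (w : ℕ) < I.size := by
  have := I.voters_lt_size; omega

theorem size_pos : 0 < I.size := lt_of_le_of_lt (Nat.zero_le _) I.voters_lt_size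

variable {o : ℕ → ℕ}

theorem inBundle_iff (ho : I.IsOffsetTable o) (w z : Fin I.nW) :
    InBundle I.size I.entry o w z ↔ z ∈ I.bundle w := by
  have h0 := size_pos (I := I)
  have hle := I.bundleStart_add_le w
  rw [mem_bundle_iff, InBundle]
  constructor
  · rintro ⟨c, hc, hoc, i, -, hi, h⟩
    rw [ho w (unreg_lt_size w) c hc 0 h0 0 h0 0 h0 0 h0, ind_ne_zero, reach_offset_iff w w.2] at hoc
    obtain ⟨rfl, -⟩ := hoc
    rw [entry_bundleStart] at hi
    exact ⟨i, hi, h⟩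
  · rintro ⟨i, hi, h⟩
    refine ⟨I.bundleStart w, bundleStart_lt w, ?_, i, by omega, by rwa [entry_bundleStart], h⟩
    rw [ho w (unreg_lt_size w) _ (bundleStart_lt w) 0 h0 0 h0 0 h0 0 h0, ind_ne_zero,
      reach_offset_iff w w.2]
    exact ⟨rfl, rfl, rfl, rfl, rfl⟩

theorem unreg_le_size : I.nW ≤ I.size := by
  have := I.voters_lt_size; omega

theorem firstCount_eq (ho : I.IsOffsetTable o) (C : ℕ → Prop) (w : Fin I.nW) :
    firstCount I.size I.entry o C w = coverage I.bundle (fun z => C z) {w} := by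
  classical
  unfold firstCount coverage
  rw [entry_two, sum_ind_eq_card unreg_le_size]
  congr 1
  ext z
  simp [inBundle_iff ho]

theorem newCount_eq (ho : I.IsOffsetTable o) (C : ℕ → Prop) (v w : Fin I.nW) :
    newCount I.size I.entry o C v w = gain I.bundle (fun z => C z) v w := by
  classical
  unfold newCount gain
  rw [entry_two, sum_ind_eq_card unreg_le_size]
  congr 1
  ext z
  simp [inBundle_iff ho]

theorem sum_pair_eq (ho : I.IsOffsetTable o) (C : ℕ → Prop) (y x : Fin I.nW) :
    (∑ z ∈ Finset.range I.size, ind (z < I.entry 2 ∧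
      (InBundle I.size I.entry o y z ∨ InBundle I.size I.entry o x z) ∧ C z)) =
      coverage I.bundle (fun z => C z) {y, x} := by
  classical
  unfold coverage
  rw [entry_two, sum_ind_eq_card unreg_le_size]
  congr 1
  ext z
  simp [inBundle_iff ho]

/-- The order of the unregistered voters by coordinates, ties being broken by numbers. -/
def leaderOrder (I : CCCAV) (key : Fin I.nV ⊕ Fin I.nW → ℕ) (w : Fin I.nW) : ℕ ×ₗ Fin I.nW :=
  toLex (key (.inr w), w)

variable {key : Fin I.nV ⊕ Fin I.nW → ℕ}

theorem leaderOrder_injective : Function.Injective (I.leaderOrder key) := by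
  intro v w h
  have := congrArg (fun q => (ofLex q).2) h
  simpa [leaderOrder] using this

theorem key_le_of_leaderOrder_le {v w : Fin I.nW} (h : I.leaderOrder key v ≤ I.leaderOrder key w) :
    key (.inr v) ≤ key (.inr w) := by
  rcases Prod.Lex.le_iff.1 h with h | h
  · exact h.le
  · exact h.1.le

theorem before_iff (hkey : ∀ u, coord I.size I.entry (I.voterIndex u) = key u) (v w : Fin I.nW) :
    Before I.size I.entry v w ↔ I.leaderOrder key v < I.leaderOrder key w := by
  have h : ∀ w : Fin I.nW, coord I.size I.entry (I.entry 1 + w) = key (.inr w) :=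
    fun w => hkey (.inr w)
  rw [Before, h, h, Prod.Lex.lt_iff]
  rfl

/-- Fullness turns bundles into balls of one common radius on the line. -/
theorem mem_bundle_iff_key (hc : IsCoordinate I.pref key) {d : ℕ} (hd : I.IsFull d)
    (x y : Fin I.nW) : y ∈ I.bundle x ↔
      (key (.inr x) - key (.inr y)) + (key (.inr y) - key (.inr x)) ≤ d := by
  rw [hd x y, ← hc (.inr x) (.inr y)]
  rfl

theorem reach_leaders_iff (ho : I.IsOffsetTable o)
    (hkey : ∀ u, coord I.size I.entry (I.voterIndex u) = key u) (hc : IsCoordinate I.pref key)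
    {d : ℕ} (hd : I.IsFull d) (Ca Cb Cc pu : ℕ → Prop) (j x y a b c : ℕ) :
    Reach I.size (ChainInit I.size I.entry o Ca Cb Cc) (ChainStep I.size I.entry o Ca Cb Cc pu)
        j x y a b c ↔
      ∃ (W : Finset (Fin I.nW)) (w v : Fin I.nW), x = w ∧ y = v ∧ W.card = j + 1 ∧
        IsChainSet (I.leaderOrder key) (fun w => pu w) W w v ∧
        a = coverage I.bundle (fun z => Ca z) W ∧ b = coverage I.bundle (fun z => Cb z) W ∧
        c = coverage I.bundle (fun z => Cc z) W := by
  have hn : I.nW < I.size := by have := I.voters_lt_size; omega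
  refine reach_chain_iff hn leaderOrder_injective ?_ ?_ ?_ j x y a b c
  -- A point within `d` of two leaders is within `d` of every leader between them.
  · intro x y z hxy hyz t hx hz
    have h1 := key_le_of_leaderOrder_le hxy
    have h2 := key_le_of_leaderOrder_le hyz
    rw [mem_bundle_iff_key hc hd] at hx hz ⊢
    omega
  · intro x y a b c
    rw [ChainInit]
    constructor
    · rintro ⟨hx, hy, h1, h2, h3⟩
      obtain ⟨w, rfl⟩ : ∃ w : Fin I.nW, x = w := ⟨⟨x, hx⟩, rfl⟩
      rw [firstCount_eq ho] at h1 h2 h3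
      exact ⟨w, rfl, hy, h1, h2, h3⟩
    · rintro ⟨w, rfl, rfl, h1, h2, h3⟩
      exact ⟨w.2, rfl, by rw [firstCount_eq ho, h1], by rw [firstCount_eq ho, h2],
        by rw [firstCount_eq ho, h3]⟩
  · intro w v a b c x' y' a' b' c'
    rw [ChainStep]
    constructor
    · rintro ⟨hx, hb, rfl, hp, h1, h2, h3⟩
      obtain ⟨w', rfl⟩ : ∃ w' : Fin I.nW, x' = w' := ⟨⟨x', hx⟩, rfl⟩
      rw [newCount_eq ho] at h1 h2 h3
      exact ⟨w', rfl, (before_iff hkey _ _).1 hb, rfl, hp.imp_left Fin.ext, h1, h2, h3⟩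
    · rintro ⟨w', rfl, hb, rfl, hp, h1, h2, h3⟩
      exact ⟨w'.2, (before_iff hkey _ _).2 hb, rfl, hp.imp_left (congrArg _),
        by rw [newCount_eq ho, h1], by rw [newCount_eq ho, h2], by rw [newCount_eq ho, h3]⟩

/-- Counting the voters of the final election. -/
theorem card_filter_finalVoters (W : Finset (Fin I.nW)) (P : Fin I.nV ⊕ Fin I.nW → Prop)
    [DecidablePred P] {C : ℕ → Prop} (hC : ∀ u, C (I.voterIndex u) ↔ P u) :
    ((I.finalVoters W).filter P).card =
      regCount I.size I.entry C + coverage I.bundle (fun z => C (I.nV + z)) W := by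
  classical
  unfold finalVoters regCount coverage
  have hn : I.nV ≤ I.size := by have := I.voters_lt_size; omega
  rw [entry_one, sum_ind_eq_card hn, ← Finset.card_disjSum]
  congr 1
  ext u
  rcases u with v | w
  · have := hC (.inl v)
    simp only [voterIndex, Sum.elim_inl] at this
    simp [this]
  · have := hC (.inr w)
    simp only [voterIndex, Sum.elim_inr] at this
    simp [this]

/-! ### Correctness of the two decisions -/

theorem coverage_empty (C : Fin I.nW → Prop) : coverage I.bundle C ∅ = 0 := by
  simp [coverage]

theorem coverage_false (W : Finset (Fin I.nW)) : coverage I.bundle (fun _ => False) W = 0 := by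
  simp [coverage]

/-- With a trivial inner condition every nonempty set of leaders is a chain, so the table lists all
attainable triples of left, supporting and right voters. -/
theorem condorcetAnswer_iff (ho : I.IsOffsetTable o) {t : ℕ → ℕ} (hsc : SingleCrossing I.pref)
    {d : ℕ} (hd : I.IsFull d)
    (ht : IsTable I.size t (Reach I.size
      (ChainInit I.size I.entry o (fun z => IsLeft I.size I.entry (I.entry 1 + z))
        (fun z => alt I.size I.entry (I.entry 1 + z) 0 = I.entry 3)
        (fun z => IsRight I.size I.entry (I.entry 1 + z)))
      (ChainStep I.size I.entry o (fun z => IsLeft I.size I.entry (I.entry 1 + z))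
        (fun z => alt I.size I.entry (I.entry 1 + z) 0 = I.entry 3)
        (fun z => IsRight I.size I.entry (I.entry 1 + z)) fun _ => True))) :
    CondorcetAnswer I.size I.entry t ↔ I.HasSolution condorcetRule := by
  classical
  obtain ⟨key, hc, hkey⟩ := I.exists_key hsc
  have hn : I.nW < I.size := by have := I.voters_lt_size; omega
  let CL : ℕ → Prop := IsLeft I.size I.entry
  let CM : ℕ → Prop := fun v => alt I.size I.entry v 0 = I.p
  let CR : ℕ → Prop := IsRight I.size I.entry
  let cov : (ℕ → Prop) → Finset (Fin I.nW) → ℕ := fun C W =>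
    coverage I.bundle (fun z => C (I.nV + z)) W
  let reg : (ℕ → Prop) → ℕ := regCount I.size I.entry
  have hwin : ∀ W, I.p ∈ condorcetRule (I.finalVoters W) I.pref ↔ I.m = 1 ∨
      IsBalanced (reg CL + cov CL W) (reg CM + cov CM W) (reg CR + cov CR W) := by
    intro W
    rw [hc.mem_condorcetRule_iff,
      card_filter_finalVoters W _ (C := CL) (isLeft_iff hkey),
      card_filter_finalVoters W _ (C := CM) (fun u => I.alt_eq_iff u I.p),
      card_filter_finalVoters W _ (C := CR) (isRight_iff hkey), IsBalanced]
  have hsol : I.HasSolution condorcetRule ↔ ∃ W : Finset (Fin I.nW), W.card ≤ I.k ∧ (I.m = 1 ∨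
      IsBalanced (reg CL + cov CL W) (reg CM + cov CM W) (reg CR + cov CR W)) :=
    exists_congr fun W => and_congr_right fun _ => hwin W
  rw [hsol, CondorcetAnswer]
  constructor
  · rintro (h | h | ⟨j, hj, hjk, x, hx, y, hy, a, ha, b, hb, c, hc', htab, hbal⟩)
    · exact ⟨∅, by simp, .inl h⟩
    · refine ⟨∅, by simp, .inr ?_⟩
      simp only [cov, coverage_empty]
      exact h
    · rw [ht j hj x hx y hy a ha b hb c hc', ind_ne_zero, reach_leaders_iff ho hkey hc hd] at htab
      obtain ⟨W, w, v, rfl, rfl, hcard, -, rfl, rfl, rfl⟩ := htab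
      rw [entry_four] at hjk
      exact ⟨W, by omega, .inr hbal⟩
  · rintro ⟨W, hW, h | h⟩
    · exact .inl h
    · rcases W.eq_empty_or_nonempty with rfl | hne
      · simp only [cov, coverage_empty] at h
        exact .inr (.inl h)
      · obtain ⟨x, y, hch⟩ := exists_isChainSet (I.leaderOrder key) hne
        have hpos := hne.card_pos
        have hcard : W.card ≤ I.nW := by simpa using Finset.card_le_univ W
        refine .inr (.inr ⟨W.card - 1, by omega, by rw [entry_four]; omega, x, unreg_lt_size x, y,
          unreg_lt_size y, cov CL W, coverage_lt hn _ _ _, cov CM W, coverage_lt hn _ _ _, cov CR W,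
          coverage_lt hn _ _ _, ?_, h⟩)
        rw [ht _ (by omega) _ (unreg_lt_size x) _ (unreg_lt_size y) _ (coverage_lt hn _ _ _) _
          (coverage_lt hn _ _ _) _ (coverage_lt hn _ _ _), ind_ne_zero,
          reach_leaders_iff ho hkey hc hd]
        exact ⟨W, x, y, rfl, rfl, by omega, hch, rfl, rfl, rfl⟩

theorem isPure_iff (ho : I.IsOffsetTable o) (w : Fin I.nW) :
    IsPure I.size I.entry o w ↔ ∀ z ∈ I.bundle w, (I.unregPref z).IsTop I.p := by
  rw [IsPure]
  constructor
  · intro h z hz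
    exact (I.alt_eq_iff (.inr z) I.p).1 (h z (unreg_lt_size z) z.2 ((inBundle_iff ho w z).2 hz))
  · intro h z _ hz hzw
    obtain ⟨z, rfl⟩ : ∃ z' : Fin I.nW, z = z' := ⟨⟨z, hz⟩, rfl⟩
    exact (I.alt_eq_iff (.inr z) I.p).2 (h z ((inBundle_iff ho w z).1 hzw))

theorem pluralityAnswer_iff (ho : I.IsOffsetTable o) {t : ℕ → ℕ} (hsc : SingleCrossing I.pref)
    {d : ℕ} (hd : I.IsFull d)
    (ht : IsTable I.size t (Reach I.size
      (ChainInit I.size I.entry o (fun _ => False)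
        (fun z => alt I.size I.entry (I.entry 1 + z) 0 = I.entry 3) (fun _ => False))
      (ChainStep I.size I.entry o (fun _ => False)
        (fun z => alt I.size I.entry (I.entry 1 + z) 0 = I.entry 3) (fun _ => False)
        (IsPure I.size I.entry o)))) :
    PluralityAnswer I.size I.entry o t ↔ I.HasSolution pluralityRule := by
  classical
  obtain ⟨key, hc, hkey⟩ := I.exists_key hsc
  have hn : I.nW < I.size := by have := I.voters_lt_size; omega
  let V : Fin I.m → ℕ := fun c => regCount I.size I.entry fun v => alt I.size I.entry v 0 = c
  have hcov : ∀ (c : Fin I.m) (W : Finset (Fin I.nW)),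
      coverage I.bundle (fun z => alt I.size I.entry (I.nV + z) 0 = c) W =
        coverage I.bundle (fun z => (I.unregPref z).IsTop c) W := by
    intro c W
    congr 1
    funext z
    exact propext (I.alt_eq_iff (.inr z) c)
  have hscore : ∀ W c, pluralityScore (I.finalVoters W) I.pref c =
      V c + coverage I.bundle (fun z => (I.unregPref z).IsTop c) W := by
    intro W c
    rw [pluralityScore, card_filter_finalVoters W _ (C := fun v => alt I.size I.entry v 0 = c)
      fun u => I.alt_eq_iff u c, hcov]
  have hsol : I.HasSolution pluralityRule ↔ ∃ W : Finset (Fin I.nW), W.card ≤ I.k ∧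
      ∀ c, c ≠ I.p → V c + coverage I.bundle (fun z => (I.unregPref z).IsTop c) W ≤
        V I.p + coverage I.bundle (fun z => (I.unregPref z).IsTop I.p) W := by
    refine exists_congr fun W => and_congr_right fun _ => ?_
    change (∀ c, _ ≤ _) ↔ _
    simp only [hscore]
    refine forall_congr' fun c => ⟨fun h _ => h, fun h => ?_⟩
    by_cases hcp : c = I.p
    · rw [hcp]
    · exact h hcp
  have hchain := exists_plurality_chain (pref := I.unregPref) (key := fun w => key (.inr w))
    (fun u v w huv hvw p h1 h2 => hc.isTop_of_between (u := .inr u) (v := .inr v) (w := .inr w)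
      huv hvw h1 h2) (f := I.leaderOrder key) (fun u v => key_le_of_leaderOrder_le)
    (mem_bundle_iff_key hc hd) V I.p I.k
  -- comparing with all alternatives among the first `size` numbers
  have hall : ∀ (F : ℕ → Prop), 0 < I.nV + I.nW →
      ((∀ c < I.size, c < I.entry 0 → c ≠ I.entry 3 → F c) ↔ ∀ c : Fin I.m, c ≠ I.p → F c) := by
    intro F hpos
    constructor
    · intro h c hcp
      exact h c (c.2.trans_le (I.m_le_size hpos)) c.2 fun e => hcp (Fin.ext e)
    · intro h c _ hcm hcp
      exact h ⟨c, hcm⟩ fun e => hcp (congrArg Fin.val e)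
  have hfirst : (∀ c < I.size, c < I.entry 0 → c ≠ I.entry 3 →
      regCount I.size I.entry (fun v => alt I.size I.entry v 0 = c) ≤
        regCount I.size I.entry fun v => alt I.size I.entry v 0 = I.entry 3) ↔
      ∀ c, c ≠ I.p → V c ≤ V I.p := by
    rcases Nat.eq_zero_or_pos (I.nV + I.nW) with h0 | h0
    -- Without voters the bounded quantifier may miss alternatives, but then all scores are 0.
    · have hz : ∀ C, regCount I.size I.entry C = 0 := by
        intro C
        refine Finset.sum_eq_zero fun v _ => ind_of_not fun h => ?_
        have := h.1
        rw [entry_one] at this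
        omega
      simp [hz, V]
    · exact hall _ h0
  rw [hsol, hchain, PluralityAnswer, hfirst]
  refine or_congr_right ?_
  constructor
  · rintro ⟨j, hj, hjk, x, hx, y, hy, b, hb, htab, hle⟩
    rw [ht j hj x hx y hy 0 size_pos b hb 0 size_pos, ind_ne_zero,
      reach_leaders_iff ho hkey hc hd] at htab
    obtain ⟨W, w, v, rfl, rfl, hcard, hch, -, rfl, -⟩ := htab
    rw [entry_four] at hjk
    refine ⟨W, w, v, by omega, ?_, ?_⟩
    · simpa only [isPure_iff ho] using hch
    · intro c hcp
      have := (hall _ (by have := w.2; omega)).1 hle c hcp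
      rw [sum_pair_eq ho (fun z => alt I.size I.entry (I.entry 1 + z) 0 = c)] at this
      simp only [entry_one, entry_three, hcov] at this
      exact this
  · rintro ⟨W, w, v, hWk, hch, hle⟩
    have hpos : 0 < W.card := Finset.card_pos.2 ⟨w, hch.last_mem⟩
    have hcard : W.card ≤ I.nW := by simpa using Finset.card_le_univ W
    -- Layers are numbered from 0, starting with a single leader.
    refine ⟨W.card - 1, by omega, by rw [entry_four]; omega, w, unreg_lt_size w, v, unreg_lt_size v,
      coverage I.bundle (fun z => (I.unregPref z).IsTop I.p) W, coverage_lt hn _ _ _, ?_, ?_⟩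
    · rw [ht _ (by omega) _ (unreg_lt_size w) _ (unreg_lt_size v) 0 size_pos _
        (coverage_lt hn _ _ _) 0 size_pos, ind_ne_zero, reach_leaders_iff ho hkey hc hd]
      refine ⟨W, w, v, rfl, rfl, by omega, ?_, (coverage_false W).symm, (hcov I.p W).symm,
        (coverage_false W).symm⟩
      simpa only [isPure_iff ho] using hch
    · refine (hall _ (by have := w.2; omega)).2 fun c hcp => ?_
      rw [sum_pair_eq ho (fun z => alt I.size I.entry (I.entry 1 + z) 0 = c)]
      simp only [entry_one, entry_three, hcov]
      exact hle c hcp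

end CCCAV

open RAM in
theorem mainTheorem1 :
    RAM.PolyTimeSolvable CCCAV.encode
      (fun I => SingleCrossing I.pref ∧ ∃ d : ℕ, I.IsFull d)
      (fun I => I.HasSolution pluralityRule) ∧
    RAM.PolyTimeSolvable CCCAV.encode
      (fun I => SingleCrossing I.pref ∧ ∃ d : ℕ, I.IsFull d)
      (fun I => I.HasSolution condorcetRule) := by
  constructor
  -- Plurality counts only supporters of p, and requires purity of the inner bundles.
  · obtain ⟨P, T, h⟩ := exists_program_of_classes compClass_false compClass_supporter
      compClass_false compClass_isPure comp_pluralityAnswer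
    refine ⟨P, T, fun I ⟨hsc, d, hd⟩ => ?_⟩
    obtain ⟨t, s, o, tab, hex, ht, ho, htab, hans⟩ := h I.encode
    exact ⟨t, s, hex, ht, hans.trans (CCCAV.pluralityAnswer_iff ho hsc hd htab)⟩
  -- Condorcet's rule uses all three counters and leaves the inner leaders unrestricted.
  · obtain ⟨P, T, h⟩ := exists_program_of_classes compClass_left compClass_supporter
      compClass_right compClass_true (answer := fun N l _ t => CondorcetAnswer N l t)
      comp_condorcetAnswer
    refine ⟨P, T, fun I ⟨hsc, d, hd⟩ => ?_⟩
    obtain ⟨t, s, o, tab, hex, ht, ho, htab, hans⟩ := h I.encode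
    exact ⟨t, s, hex, ht, hans.trans (CCCAV.condorcetAnswer_iff ho hsc hd htab)⟩
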